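/- Let $N\ge 1$ and $M\ge 1$ be integers, and let $(\Omega,\mathcal F,(\mathcal F_n)_{0\le n\le N},\mathbb P)$ be a filtered probability space. The prices of $M$ risky assets are an adapted process $S=(S_n)_{0\le n\le N}$ of column vectors in $\mathbb R^M$ that is locally square integrable: with $\Delta S_n=S_n-S_{n-1}$ and $\Delta S_0=0$, $\mathbb E[(\Delta S_{na})^2\mid\mathcal F_{n-1}]<\infty$ almost surely for all $1\le n\le N$ and all coordinates $a$. The weights $\omega_n\in[0,1]$ and the claims $H_n\in L^2(\mathbb P)$, $0\le n\le N$, are real-valued and adapted. Conditional expectations are understood in the generalised sense $\mathbb E[X\mid\mathcal G]=\mathbb E[X^+\mid\mathcal G]-\mathbb E[X^-\mid\mathcal G]$, which is well defined when $\mathbb E[|X|\mid\mathcal G]<\infty$ almost surely. Empty sums are $0$ and empty products are $1$. An admissible strategy is a predictable process $\xi=(\xi_n)_{1\le n\le N}$ in $\mathbb R^M$ (each $\xi_n$ is $\mathcal F_{n-1}$-measurable; no integrability is required), with gains $G_n(\xi)=\sum_{i=1}^n\xi_i^\top\Delta S_i$, $G_0(\xi)=G_{-1}(\xi)=0$. For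 $c\in\mathbb R$ let $$\mathcal J(\xi;c)=\sum_{n=0}^N\mathbb E\big[\omega_n\,(H_n-c-G_n(\xi))^2\big]\in[0,\infty],\qquad V(c)=\inf_{\xi\text{ admissible}}\mathcal J(\xi;c).$$ Define, by backward induction over $n=N,N-1,\dots,1$, the $\mathcal F_{n-1}$-measurable vectors $\alpha_n,\eta_n,\beta_n,\rho_n\in\mathbb R^M$ and symmetric matrices $\delta_n\in\mathbb R^{M\times M}$ by $$\alpha_n=\mathbb E\Big[\Delta S_n\sum_{i=n}^N\omega_i\prod_{j=n+1}^i(1-\beta_j^\top\Delta S_j)\,\Big|\,\mathcal F_{n-1}\Big],\qquad \eta_n=\mathbb E\Big[\Delta S_n\sum_{i=n}^NH_i\,\omega_i\prod_{j=n+1}^i(1-\beta_j^\top\Delta S_j)\,\Big|\,\mathcal F_{n-1}\Big],$$ $$\delta_n=\mathbb E\Big[\Delta S_n\Delta S_n^\top\sum_{i=n}^N\omega_i\prod_{j=n+1}^i(1-\beta_j^\top\Delta S_j)^2\,\Big|\,\mathcal F_{n-1}\Big],\qquad \beta_n=\delta_n^{+}\alpha_n,\qquad \rho_n=\delta_n^{+}\eta_n,$$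 where $\delta^{+}$ is the Moore–Penrose inverse (so for $M=1$ these are the quotients $\alpha_n/\delta_n$, $\eta_n/\delta_n$ with $0/0=0$); put $\beta_0=\rho_0=0$. For $c\in\mathbb R$ define $\xi^\star=\xi^\star(c)$ recursively by $$\xi^\star_n=\rho_n-\beta_n\big(c+G_{n-1}(\xi^\star)\big),\qquad 1\le n\le N.$$ Then all conditional expectations above are well defined, $\delta_n\beta_n=\alpha_n$ and $\delta_n\rho_n=\eta_n$ almost surely for $1\le n\le N$, and for every $c\in\mathbb R$: (a) $\xi^\star(c)$ is admissible and minimises $\mathcal J(\cdot\,;c)$ over all admissible strategies, and $V(c)=\mathcal J(\xi^\star(c);c)<\infty$. (b) With $Z_n=\omega_n\prod_{i=1}^n(1-\beta_i^\top\Delta S_i)$, $$V(c)=c^2\sum_{n=0}^N\mathbb E(Z_n)-2c\sum_{n=0}^N\mathbb E(Z_nH_n)+\sum_{n=0}^N\mathbb E\bigg(\omega_n\Big(H_n-\sum_{i=1}^n\rho_i^\top\Delta S_i\prod_{j=i+1}^n(1-\beta_j^\top\Delta S_j)\Big)^2\bigg),$$ where all the expectations are finite. (c) For all $0\le n\le N$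 and $0\le k\le n+1$, $$H_n-c-G_n(\xi^\star)=H_n-\sum_{i=k}^n\rho_i^\top\Delta S_i\prod_{j=i+1}^n(1-\beta_j^\top\Delta S_j)-\big(c+G_{k-1}(\xi^\star)\big)\prod_{i=k}^n(1-\beta_i^\top\Delta S_i).$$ -/

import Mathlib

open MeasureTheory Finset Matrix
open scoped ENNReal

/-! ## Generalised conditional expectation

Increments of the price process are only locally square integrable, hence need not be integrable.
The conditional expectations below are therefore the usual extended ones,
`E[X | m] = E[X⁺ | m] - E[X⁻ | m]`, meaningful as soon as `E[|X| | m] < ∞` almost surely. -/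

section CondExp

variable {Ω : Type*} [mΩ : MeasurableSpace Ω]

/-- `E[|X| | m] < ∞` almost surely. -/
def CondIntegrable (μ : Measure Ω) (m : MeasurableSpace Ω) (X : Ω → ℝ) : Prop :=
  ∀ᵐ x ∂μ, condLExp m μ (fun y => ENNReal.ofReal |X y|) x < ∞

/-- `E[X | m] = E[X⁺ | m] - E[X⁻ | m]`. -/
noncomputable def genCondExp (μ : Measure Ω) (m : MeasurableSpace Ω) (X : Ω → ℝ) : Ω → ℝ :=
  fun x => (condLExp m μ (fun y => ENNReal.ofReal (X y)) x).toReal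
    - (condLExp m μ (fun y => ENNReal.ofReal (-X y)) x).toReal

end CondExp

/-! ## Moore-Penrose inverse of a symmetric real matrix -/

section PseudoInverse

variable {M : ℕ}

/-- The Moore-Penrose inverse of a symmetric real matrix: in an orthonormal eigenbasis every
nonzero eigenvalue `t` becomes `t⁻¹`, and the eigenvalue `0` stays `0`. -/
noncomputable def symPinv (A : Matrix (Fin M) (Fin M) ℝ) : Matrix (Fin M) (Fin M) ℝ :=
  cfc (fun t : ℝ => t⁻¹) A

lemma symPinv_continuousOn (A : Matrix (Fin M) (Fin M) ℝ) (f : ℝ → ℝ) :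
    ContinuousOn f (spectrum ℝ A) :=
  (Matrix.finite_real_spectrum (A := A)).continuousOn f

/-- The four Penrose equations, which characterise the Moore-Penrose inverse. -/
theorem symPinv_penrose {A : Matrix (Fin M) (Fin M) ℝ} (hA : A.IsSymm) :
    A * symPinv A * A = A ∧ symPinv A * A * symPinv A = symPinv A ∧
      (A * symPinv A).IsSymm ∧ (symPinv A * A).IsSymm := by
  have hsa : IsSelfAdjoint A := by
    rw [isSelfAdjoint_iff, Matrix.star_eq_conjTranspose, Matrix.conjTranspose_eq_transpose_of_trivial]
    exact hA
  have hc := symPinv_continuousOn A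
  have h1 : A * symPinv A = cfc (fun t : ℝ => t * t⁻¹) A := by
    rw [symPinv, cfc_mul (fun t : ℝ => t) (fun t : ℝ => t⁻¹) A (hc _) (hc _), cfc_id' ℝ A]
  have h2 : symPinv A * A = cfc (fun t : ℝ => t * t⁻¹) A := by
    have := cfc_mul (fun t : ℝ => t⁻¹) (fun t : ℝ => t) A (hc _) (hc _)
    rw [cfc_id' ℝ A] at this
    rw [symPinv, ← this]
    simp only [mul_comm]
  have hsym : (cfc (fun t : ℝ => t * t⁻¹) A).IsSymm := by
    have := IsSelfAdjoint.cfc (f := fun t : ℝ => t * t⁻¹) (a := A)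
    rw [isSelfAdjoint_iff, Matrix.star_eq_conjTranspose,
      Matrix.conjTranspose_eq_transpose_of_trivial] at this
    exact this
  refine ⟨?_, ?_, h1 ▸ hsym, h2 ▸ hsym⟩
  · have := cfc_mul (fun t : ℝ => t * t⁻¹) (fun t : ℝ => t) A (hc _) (hc _)
    rw [cfc_id' ℝ A] at this
    rw [h1, ← this]
    simp only [mul_inv_mul_cancel]
    exact cfc_id' ℝ A
  · rw [h2, symPinv, ← cfc_mul (fun t : ℝ => t * t⁻¹) (fun t : ℝ => t⁻¹) A (hc _) (hc _)]
    congr 1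
    funext t
    by_cases ht : t = 0
    · simp [ht]
    · field_simp

end PseudoInverse

/-! ## The hedging problem -/

/-- The data of a sequential quadratic hedging problem with `M` risky assets: the number `N` of
periods, the filtration, the price process, the random weights and the claims. Only the times
`0, …, N` matter. -/
structure HedgingProblem (Ω : Type*) [mΩ : MeasurableSpace Ω] (M : ℕ) where
  N : ℕ
  filt : Filtration ℕ mΩ
  S : ℕ → Ω → Fin M → ℝ
  w : ℕ → Ω → ℝ
  H : ℕ → Ω → ℝ

namespace HedgingProblem

variable {Ω : Type*} [mΩ : MeasurableSpace Ω] {M : ℕ} (P : HedgingProblem Ω M)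

/-- Price increments `ΔS_n = S_n - S_{n-1}`, with `ΔS_0 = 0`. -/
def dS : ℕ → Ω → Fin M → ℝ
  | 0 => 0
  | n + 1 => P.S (n + 1) - P.S n

/-- A hedging strategy `ξ_1, …, ξ_N` is admissible if it is predictable: `ξ_n` is measurable with
respect to the information at time `n - 1`. (Self-financing is built into `gain`.) -/
def Admissible (ξ : ℕ → Ω → Fin M → ℝ) : Prop :=
  ∀ n, n < P.N → Measurable[P.filt n] (ξ (n + 1))

/-- The gain process `G_n(ξ) = ∑_{i=1}^n ξ_iᵀ ΔS_i`, with `G_0(ξ) = 0`. -/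
def gain (ξ : ℕ → Ω → Fin M → ℝ) (n : ℕ) (x : Ω) : ℝ :=
  ∑ i ∈ Icc 1 n, ξ i x ⬝ᵥ P.dS i x

/-- `gainBefore ξ k = G_{k-1}(ξ)`, with `G_{-1}(ξ) = 0`. -/
def gainBefore (ξ : ℕ → Ω → Fin M → ℝ) : ℕ → Ω → ℝ
  | 0 => 0
  | k + 1 => P.gain ξ k

/-- The hedging error `J(ξ; c) = ∑_{n=0}^N E[w_n (H_n - c - G_n(ξ))²] ∈ [0, ∞]`. -/
noncomputable def cost (μ : Measure Ω) (ξ : ℕ → Ω → Fin M → ℝ) (c : ℝ) : ℝ≥0∞ :=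
  ∑ n ∈ range (P.N + 1), ∫⁻ x, ENNReal.ofReal (P.w n x * (P.H n x - c - P.gain ξ n x) ^ 2) ∂μ

/-- The value function: the infimum of `J(ξ; c)` over the admissible strategies. -/
noncomputable def value (μ : Measure Ω) (c : ℝ) : ℝ≥0∞ :=
  ⨅ (ξ : ℕ → Ω → Fin M → ℝ) (_ : P.Admissible ξ), P.cost μ ξ c

/-- `∏_{j=n}^{i} (1 - b_jᵀ ΔS_j)`. -/
def tailProd (b : ℕ → Ω → Fin M → ℝ) (n i : ℕ) (x : Ω) : ℝ :=
  ∏ j ∈ Icc n i, (1 - b j x ⬝ᵥ P.dS j x)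

/-- `ΔS_n ∑_{i=n}^N w_i ∏_{j=n+1}^i (1 - b_jᵀ ΔS_j)`, coordinate `a`. -/
def alphaArg (b : ℕ → Ω → Fin M → ℝ) (n : ℕ) (a : Fin M) (x : Ω) : ℝ :=
  P.dS n x a * ∑ i ∈ Icc n P.N, P.w i x * P.tailProd b (n + 1) i x

/-- `ΔS_n ∑_{i=n}^N H_i w_i ∏_{j=n+1}^i (1 - b_jᵀ ΔS_j)`, coordinate `a`. -/
def etaArg (b : ℕ → Ω → Fin M → ℝ) (n : ℕ) (a : Fin M) (x : Ω) : ℝ :=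
  P.dS n x a * ∑ i ∈ Icc n P.N, P.H i x * P.w i x * P.tailProd b (n + 1) i x

/-- `ΔS_n ΔS_nᵀ ∑_{i=n}^N w_i ∏_{j=n+1}^i (1 - b_jᵀ ΔS_j)²`, entry `(a, a')`. -/
def deltaArg (b : ℕ → Ω → Fin M → ℝ) (n : ℕ) (a a' : Fin M) (x : Ω) : ℝ :=
  P.dS n x a * P.dS n x a' * ∑ i ∈ Icc n P.N, P.w i x * P.tailProd b (n + 1) i x ^ 2

/-- The vector `E[alphaArg | F_{n-1}]`. -/
noncomputable def alphaOf (μ : Measure Ω) (b : ℕ → Ω → Fin M → ℝ) (n : ℕ) (x : Ω) : Fin M → ℝ :=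
  fun a => genCondExp μ (P.filt (n - 1)) (P.alphaArg b n a) x

/-- The vector `E[etaArg | F_{n-1}]`. -/
noncomputable def etaOf (μ : Measure Ω) (b : ℕ → Ω → Fin M → ℝ) (n : ℕ) (x : Ω) : Fin M → ℝ :=
  fun a => genCondExp μ (P.filt (n - 1)) (P.etaArg b n a) x

/-- The symmetric matrix `E[deltaArg | F_{n-1}]`. -/
noncomputable def deltaOf (μ : Measure Ω) (b : ℕ → Ω → Fin M → ℝ) (n : ℕ) (x : Ω) :
    Matrix (Fin M) (Fin M) ℝ :=
  Matrix.of fun a a' => genCondExp μ (P.filt (n - 1)) (P.deltaArg b n a a') x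

theorem deltaOf_isSymm (μ : Measure Ω) (b : ℕ → Ω → Fin M → ℝ) (n : ℕ) (x : Ω) :
    (P.deltaOf μ b n x).IsSymm := by
  ext a a'
  have h : P.deltaArg b n a' a = P.deltaArg b n a a' := by
    funext y
    simp only [deltaArg, mul_comm (P.dS n y a')]
  simp only [deltaOf, Matrix.transpose_apply, Matrix.of_apply, h]

/-- The process `β`, by backward induction: for `n = N, N-1, …, 1`, `β_n = δ_n⁺ α_n`, where `α_n`
and `δ_n` are built from `β_{n+1}, …, β_N`; it is `0` at all other times. See `beta_eq`. -/
noncomputable def beta (μ : Measure Ω) (n : ℕ) : Ω → Fin M → ℝ :=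
  if _h : 1 ≤ n ∧ n ≤ P.N then
    let later : ℕ → Ω → Fin M → ℝ := fun j => if _hj : n < j then beta μ j else 0
    fun x => symPinv (P.deltaOf μ later n x) *ᵥ P.alphaOf μ later n x
  else 0
termination_by P.N + 1 - n
decreasing_by omega

/-- The process `α`. -/
noncomputable def alpha (μ : Measure Ω) : ℕ → Ω → Fin M → ℝ := P.alphaOf μ (P.beta μ)

/-- The process `η`. -/
noncomputable def eta (μ : Measure Ω) : ℕ → Ω → Fin M → ℝ := P.etaOf μ (P.beta μ)

/-- The matrix process `δ`. -/
noncomputable def delta (μ : Measure Ω) : ℕ → Ω → Matrix (Fin M) (Fin M) ℝ :=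
  P.deltaOf μ (P.beta μ)

/-- The process `ρ`: `ρ_n = δ_n⁺ η_n` for `1 ≤ n ≤ N`, and `0` at all other times. -/
noncomputable def rho (μ : Measure Ω) (n : ℕ) : Ω → Fin M → ℝ :=
  if 1 ≤ n ∧ n ≤ P.N then fun x => symPinv (P.delta μ n x) *ᵥ P.eta μ n x else 0

lemma tailProd_congr {b b' : ℕ → Ω → Fin M → ℝ} {n : ℕ} (h : ∀ j, n < j → b j = b' j)
    (i : ℕ) (x : Ω) : P.tailProd b (n + 1) i x = P.tailProd b' (n + 1) i x := by
  unfold tailProd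
  refine Finset.prod_congr rfl fun j hj => ?_
  rw [h j (by have := (Finset.mem_Icc.1 hj).1; omega)]

/-- The defining recursion of `β`. -/
theorem beta_eq (μ : Measure Ω) {n : ℕ} (h1 : 1 ≤ n) (hN : n ≤ P.N) (x : Ω) :
    P.beta μ n x = symPinv (P.delta μ n x) *ᵥ P.alpha μ n x := by
  have hp := P.tailProd_congr (b := fun j => if _hj : n < j then P.beta μ j else 0)
    (b' := P.beta μ) fun j hj => dif_pos hj
  have ha : P.alphaArg (fun j => if _hj : n < j then P.beta μ j else 0) n =
      P.alphaArg (P.beta μ) n := by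
    funext a y
    simp only [alphaArg, hp]
  have hd : P.deltaArg (fun j => if _hj : n < j then P.beta μ j else 0) n =
      P.deltaArg (P.beta μ) n := by
    funext a a' y
    simp only [deltaArg, hp]
  conv_lhs => rw [beta]
  rw [dif_pos ⟨h1, hN⟩]
  simp only [delta, alpha, deltaOf]
  rw [hd]
  unfold alphaOf
  rw [ha]

/-- The gain of the recursive strategy together with the strategy itself: `optGain n` is
`G_n(ξ*)`, see `gain_optStrategy`. -/
noncomputable def optGain (μ : Measure Ω) (c : ℝ) : ℕ → Ω → ℝ
  | 0 => 0
  | n + 1 => fun x => optGain μ c n x +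
      (P.rho μ (n + 1) x - (c + optGain μ c n x) • P.beta μ (n + 1) x) ⬝ᵥ P.dS (n + 1) x

/-- The strategy `ξ*(c)` given by `ξ*_n = ρ_n - β_n (c + G_{n-1}(ξ*))`, see `optStrategy_eq`. -/
noncomputable def optStrategy (μ : Measure Ω) (c : ℝ) : ℕ → Ω → Fin M → ℝ
  | 0 => 0
  | n + 1 => fun x => P.rho μ (n + 1) x - (c + P.optGain μ c n x) • P.beta μ (n + 1) x

theorem gain_optStrategy (μ : Measure Ω) (c : ℝ) (n : ℕ) (x : Ω) :
    P.gain (P.optStrategy μ c) n x = P.optGain μ c n x := by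
  induction n with
  | zero => simp [gain, optGain]
  | succ n ih =>
    rw [gain, Finset.sum_Icc_succ_top (by omega), ← gain, ih]
    rfl

theorem optStrategy_eq (μ : Measure Ω) (c : ℝ) {n : ℕ} (hn : 1 ≤ n) (x : Ω) :
    P.optStrategy μ c n x =
      P.rho μ n x - (c + P.gain (P.optStrategy μ c) (n - 1) x) • P.beta μ n x := by
  obtain ⟨k, rfl⟩ : ∃ k, n = k + 1 := ⟨n - 1, by omega⟩
  rw [Nat.add_sub_cancel, gain_optStrategy]
  rfl

/-- `Z_n = w_n ∏_{i=1}^n (1 - β_iᵀ ΔS_i)`. -/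
noncomputable def Z (μ : Measure Ω) (n : ℕ) (x : Ω) : ℝ :=
  P.w n x * P.tailProd (P.beta μ) 1 n x

/-- `∑_{i=k}^n ρ_iᵀ ΔS_i ∏_{j=i+1}^n (1 - β_jᵀ ΔS_j)`. -/
noncomputable def rhoSum (μ : Measure Ω) (k n : ℕ) (x : Ω) : ℝ :=
  ∑ i ∈ Icc k n, (P.rho μ i x ⬝ᵥ P.dS i x) * P.tailProd (P.beta μ) (i + 1) n x

end HedgingProblem

/-! This is dynamic programming with a quadratic value function. Start at time n with wealth y = c +
G_n and follow ξ* afterwards. The wealth recursion is affine, so the error at time i is R_i - y T_i,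
where T_i is the product of 1 - β_jᵀΔS_j over n < j ≤ i and R_i is the claim minus `rhoSum` from n +
1. The remaining weighted squared error is therefore y² A_n - 2y D_n + Q_n, with A, D, Q the sums
`sumA`, `sumD`, `sumQ`. Choosing ξ_{n+1} is a conditional least squares problem with normal
equations δ ξ = E[ΔS (D - yA) | F_n], where ΔS, A, D and δ are taken at n + 1.

The definitions of α and η use instead B = `sumB` and C = `sumC`, which are linear in T and do not
involve ρ. Orthogonality reconciles the two: the normal equations at later dates give E[A_n | F_n] =
E[B_n | F_n] and E[D_n | F_n] = E[C_n | F_n]. Hence α = E[ΔS A | F_n] and η = E[ΔS D | F_n], and ξ =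
ρ - yβ solves the normal equations (`Invariant.alpha_eq`, `Invariant.eta_eq`,
`Invariant.lintegral_quadratic_le`). They are solvable although δ may be singular, because B and C
vanish wherever A does (`condMoment_mulVec_symPinv`).

Since ΔS is only locally square integrable, integrability must be carried along the backward
induction. The structure `Invariant` adds to the two identities a deterministic bound on E[A_n |
F_n] and finiteness of E[Q_n]. Both pass to n because the optimal position does no worse than the
zero position.

Optimality follows by replacing an arbitrary strategy by ξ* from the last date backwards, with costs
in [0, ∞], so no integrability of the competitor is needed. Integrating the quadratic at time 0,
with E[A_0] = E[B_0] and E[D_0] = E[C_0], gives the formula for V(c). -/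

/-! ### Generalised conditional expectations: linearity, pull-out, tower property. -/

section Toolkit

variable {Ω : Type*} {m m' : MeasurableSpace Ω} [mΩ : MeasurableSpace Ω] {μ : Measure Ω}

/-- Pull-out property of the Lebesgue conditional expectation. -/
theorem condLExp_mul_left [IsFiniteMeasure μ] (hm : m ≤ mΩ) {Y X : Ω → ℝ≥0∞}
    (hY : Measurable[m] Y) (hX : Measurable X) :
    condLExp m μ (fun x => Y x * X x) =ᵐ[μ] fun x => Y x * condLExp m μ X x := by
  refine (ae_eq_condLExp hm _ _ (hY.mul (measurable_condLExp m μ X)) fun s hs => ?_).symm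
  have hE := measurable_condLExp' m μ X
  -- The densities X and E[X | m] induce the same measure on m, so they give the same integral to
  -- every m-measurable function.
  have htrim : (μ.withDensity X).trim hm = (μ.withDensity (condLExp m μ X)).trim hm := by
    refine @Measure.ext _ m _ _ fun t ht => ?_
    rw [trim_measurableSet_eq hm ht, trim_measurableSet_eq hm ht, withDensity_apply _ (hm t ht),
      withDensity_apply _ (hm t ht), setLIntegral_condLExp hm μ X ht]
  have key : ∀ Z : Ω → ℝ≥0∞, Measurable Z → ∫⁻ x in s, Y x * Z x ∂μ =
      ∫⁻ x, s.indicator Y x ∂(μ.withDensity Z) := by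
    intro Z hZ
    rw [lintegral_withDensity_eq_lintegral_mul _ hZ ((hY.mono hm le_rfl).indicator (hm s hs)),
      ← lintegral_indicator (hm s hs)]
    refine lintegral_congr fun x => ?_
    by_cases hx : x ∈ s <;> simp [hx, mul_comm]
  simp only [Pi.mul_apply]
  rw [key _ hE, key _ hX, ← lintegral_trim hm (hY.indicator hs),
    ← lintegral_trim hm (hY.indicator hs), htrim]

/-- Tower property of the Lebesgue conditional expectation. -/
theorem condLExp_condLExp_of_le [IsFiniteMeasure μ] (hmm : m ≤ m')
    (hm : m' ≤ mΩ) (X : Ω → ℝ≥0∞) :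
    condLExp m μ (condLExp m' μ X) =ᵐ[μ] condLExp m μ X := by
  refine ae_eq_condLExp (hmm.trans hm) _ _ (measurable_condLExp _ _ _) fun s hs => ?_
  rw [setLIntegral_condLExp (hmm.trans hm) _ _ hs, setLIntegral_condLExp hm _ _ (hmm s hs)]

/-- Measurable and conditionally integrable. -/
structure IsCondInt {Ω : Type*} (m : MeasurableSpace Ω) [mΩ : MeasurableSpace Ω]
    (μ : Measure Ω) (X : Ω → ℝ) : Prop where
  meas : Measurable X
  condInt : CondIntegrable μ m X

theorem IsCondInt.mono {X Y : Ω → ℝ} (hY : IsCondInt m μ Y) (hX : Measurable X)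
    (h : ∀ᵐ x ∂μ, |X x| ≤ Y x) : IsCondInt m μ X := by
  refine ⟨hX, ?_⟩
  have := condLExp_mono (mΩ := m) (P := μ) (X := fun x => ENNReal.ofReal |X x|)
    (Y := fun x => ENNReal.ofReal |Y x|) (by
      filter_upwards [h] with x hx using ENNReal.ofReal_le_ofReal (hx.trans (le_abs_self _)))
  filter_upwards [this, hY.condInt] with x h1 h2 using h1.trans_lt h2

theorem IsCondInt.add {X Y : Ω → ℝ} (hX : IsCondInt m μ X) (hY : IsCondInt m μ Y) :
    IsCondInt m μ fun x => X x + Y x := by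
  refine ⟨hX.meas.add hY.meas, ?_⟩
  have h1 := condLExp_mono (mΩ := m) (P := μ) (X := fun x => ENNReal.ofReal |X x + Y x|)
    (Y := (fun x => ENNReal.ofReal |X x|) + fun x => ENNReal.ofReal |Y x|) (by
      refine ae_of_all _ fun x => ?_
      simp only [Pi.add_apply]
      rw [← ENNReal.ofReal_add (abs_nonneg _) (abs_nonneg _)]
      exact ENNReal.ofReal_le_ofReal (abs_add_le _ _))
  have h2 := condLExp_add_left (mΩ := m) (P := μ) (fun x => ENNReal.ofReal |Y x|)
    (X := fun x => ENNReal.ofReal |X x|) (by have := hX.meas; fun_prop)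
  filter_upwards [h1, h2, hX.condInt, hY.condInt] with x h1 h2 h3 h4
  rw [h2] at h1
  exact h1.trans_lt (ENNReal.add_lt_top.2 ⟨h3, h4⟩)

theorem IsCondInt.mul_left [IsFiniteMeasure μ] (hm : m ≤ mΩ) {g X : Ω → ℝ}
    (hg : Measurable[m] g) (hX : IsCondInt m μ X) : IsCondInt m μ fun x => g x * X x := by
  refine ⟨(hg.mono hm le_rfl).mul hX.meas, ?_⟩
  have h1 := condLExp_mul_left (μ := μ) hm (Y := fun x => ENNReal.ofReal |g x|)
    (X := fun x => ENNReal.ofReal |X x|)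
    (ENNReal.measurable_ofReal.comp (measurable_norm.comp hg))
    (by have := hX.meas; fun_prop)
  unfold CondIntegrable
  simp_rw [abs_mul, ENNReal.ofReal_mul (abs_nonneg _)]
  filter_upwards [h1, hX.condInt] with x h1 h2
  rw [h1]
  exact ENNReal.mul_lt_top ENNReal.ofReal_lt_top h2

theorem IsCondInt.neg {X : Ω → ℝ} (hX : IsCondInt m μ X) : IsCondInt m μ fun x => -X x :=
  ⟨hX.meas.neg, by have := hX.condInt; simpa only [CondIntegrable, abs_neg] using this⟩

theorem IsCondInt.sub {X Y : Ω → ℝ} (hX : IsCondInt m μ X) (hY : IsCondInt m μ Y) :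
    IsCondInt m μ fun x => X x - Y x := by
  simpa only [sub_eq_add_neg] using hX.add hY.neg

theorem IsCondInt.of_integrable {X : Ω → ℝ} (hX : Measurable X) (h : Integrable X μ) :
    IsCondInt m μ X := by
  refine ⟨hX, condLExp_lt_top ?_⟩
  have := h.hasFiniteIntegral.ne
  simpa only [← ofReal_norm, Real.norm_eq_abs] using this

theorem IsCondInt.zero : IsCondInt m μ (fun _ => (0 : ℝ)) := by
  refine ⟨measurable_const, ?_⟩
  unfold CondIntegrable
  simp only [abs_zero, ENNReal.ofReal_zero]
  have : condLExp m μ (fun _ => (0 : ℝ≥0∞)) = 0 := condLExp_zero μ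
  simp [this]

theorem IsCondInt.sum {ι : Type*} (s : Finset ι) {X : ι → Ω → ℝ}
    (h : ∀ i ∈ s, IsCondInt m μ (X i)) : IsCondInt m μ fun x => ∑ i ∈ s, X i x := by
  classical
  induction s using Finset.induction_on with
  | empty => simpa using IsCondInt.zero
  | insert i s hi ih =>
    simp only [Finset.sum_insert hi]
    exact (h i (by simp)).add (ih fun j hj => h j (by simp [hj]))

theorem IsCondInt.pos_lt_top {X : Ω → ℝ} (hX : IsCondInt m μ X) :
    ∀ᵐ x ∂μ, condLExp m μ (fun y => ENNReal.ofReal (X y)) x < ∞ := by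
  have := condLExp_mono (mΩ := m) (P := μ) (X := fun x => ENNReal.ofReal (X x))
    (Y := fun x => ENNReal.ofReal |X x|)
    (ae_of_all _ fun x => ENNReal.ofReal_le_ofReal (le_abs_self _))
  filter_upwards [this, hX.condInt] with x h1 h2 using h1.trans_lt h2

theorem measurable_genCondExp (X : Ω → ℝ) : Measurable[m] (genCondExp μ m X) :=
  (measurable_condLExp m μ _).ennreal_toReal.sub (measurable_condLExp m μ _).ennreal_toReal

theorem genCondExp_congr {X Y : Ω → ℝ} (h : X =ᵐ[μ] Y) :
    genCondExp μ m X =ᵐ[μ] genCondExp μ m Y := by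
  have h1 := condLExp_congr_ae (mΩ := m) (P := μ) (X := fun x => ENNReal.ofReal (X x))
    (Y := fun x => ENNReal.ofReal (Y x)) (by filter_upwards [h] with x hx; rw [hx])
  have h2 := condLExp_congr_ae (mΩ := m) (P := μ) (X := fun x => ENNReal.ofReal (-X x))
    (Y := fun x => ENNReal.ofReal (-Y x)) (by filter_upwards [h] with x hx; rw [hx])
  filter_upwards [h1, h2] with x h1 h2
  simp only [genCondExp, h1, h2]

/-- The generalised conditional expectation may be computed from any decomposition into a
difference of nonnegative conditionally integrable functions. -/
theorem genCondExp_eq_of_sub {X U V : Ω → ℝ} (hX : Measurable X) (hU : IsCondInt m μ U)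
    (hV : IsCondInt m μ V) (hU0 : ∀ x, 0 ≤ U x) (hV0 : ∀ x, 0 ≤ V x)
    (h : X =ᵐ[μ] fun x => U x - V x) :
    genCondExp μ m X =ᵐ[μ] fun x => (condLExp m μ (fun y => ENNReal.ofReal (U y)) x).toReal -
      (condLExp m μ (fun y => ENNReal.ofReal (V y)) x).toReal := by
  have hXi : IsCondInt m μ X := (hU.add hV).mono hX (by
    filter_upwards [h] with x hx
    rw [hx, abs_le]
    constructor <;> linarith [hU0 x, hV0 x])
  have hmU := hU.meas
  have hmV := hV.meas
  have e1 := condLExp_add_left (mΩ := m) (P := μ) (fun x => ENNReal.ofReal (V x))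
    (X := fun x => ENNReal.ofReal (X x)) (by fun_prop)
  have e2 := condLExp_add_left (mΩ := m) (P := μ) (fun x => ENNReal.ofReal (U x))
    (X := fun x => ENNReal.ofReal (-X x)) (by fun_prop)
  -- X = U - V is rewritten as X⁺ + V = X⁻ + U, an identity in [0, ∞] that needs no subtraction
  -- before conditioning.
  have e3 := condLExp_congr_ae (mΩ := m) (P := μ)
    (X := (fun x => ENNReal.ofReal (X x)) + fun x => ENNReal.ofReal (V x))
    (Y := (fun x => ENNReal.ofReal (-X x)) + fun x => ENNReal.ofReal (U x)) (by
      filter_upwards [h] with x hx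
      simp only [Pi.add_apply]
      rcases le_total 0 (X x) with h0 | h0
      · rw [ENNReal.ofReal_of_nonpos (by linarith : -X x ≤ 0), zero_add,
          ← ENNReal.ofReal_add h0 (hV0 x), hx, sub_add_cancel]
      · rw [ENNReal.ofReal_of_nonpos h0, zero_add,
          ← ENNReal.ofReal_add (by linarith) (hU0 x), hx]
        congr 1; ring)
  filter_upwards [e1, e2, e3, hXi.pos_lt_top, hXi.neg.pos_lt_top, hU.pos_lt_top, hV.pos_lt_top]
    with x e1 e2 e3 f1 f2 f3 f4
  rw [e1, e2, Pi.add_apply, Pi.add_apply] at e3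
  have := congrArg ENNReal.toReal e3
  rw [ENNReal.toReal_add f1.ne f4.ne, ENNReal.toReal_add f2.ne f3.ne] at this
  simp only [genCondExp]
  linarith

theorem IsCondInt.posPart {X : Ω → ℝ} (hX : IsCondInt m μ X) :
    IsCondInt m μ fun x => max (X x) 0 := by
  refine ⟨hX.meas.max measurable_const, ?_⟩
  have := condLExp_mono (mΩ := m) (P := μ) (X := fun x => ENNReal.ofReal |max (X x) 0|)
    (Y := fun x => ENNReal.ofReal |X x|)
    (ae_of_all _ fun x => ENNReal.ofReal_le_ofReal (by
      rw [abs_of_nonneg (le_max_right _ _)]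
      exact max_le (le_abs_self _) (abs_nonneg _)))
  filter_upwards [this, hX.condInt] with x h1 h2 using h1.trans_lt h2

theorem ENNReal.ofReal_max_zero (r : ℝ) : ENNReal.ofReal (max r 0) = ENNReal.ofReal r := by
  rcases le_total 0 r with h | h
  · rw [max_eq_left h]
  · rw [max_eq_right h, ENNReal.ofReal_zero, ENNReal.ofReal_of_nonpos h]

theorem max_zero_sub_max_neg_zero (r : ℝ) : max r 0 - max (-r) 0 = r := by
  rcases le_total 0 r with h | h
  · rw [max_eq_left h, max_eq_right (by linarith), sub_zero]
  · rw [max_eq_right h, max_eq_left (by linarith)]; ring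

theorem condLExp_ofReal_add {U V : Ω → ℝ} (hU : Measurable U) (hU0 : ∀ x, 0 ≤ U x)
    (hV0 : ∀ x, 0 ≤ V x) :
    condLExp m μ (fun x => ENNReal.ofReal (U x + V x)) =ᵐ[μ] fun x =>
      condLExp m μ (fun x => ENNReal.ofReal (U x)) x +
      condLExp m μ (fun x => ENNReal.ofReal (V x)) x := by
  simp_rw [ENNReal.ofReal_add (hU0 _) (hV0 _)]
  exact condLExp_add_left (mΩ := m) (P := μ) (fun x => ENNReal.ofReal (V x))
    (X := fun x => ENNReal.ofReal (U x)) (by fun_prop)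

/-- Positive parts are not additive, but X + Y = (X⁺ + Y⁺) - (X⁻ + Y⁻) is an admissible
decomposition for `genCondExp_eq_of_sub`. -/
theorem genCondExp_add {X Y : Ω → ℝ} (hX : IsCondInt m μ X) (hY : IsCondInt m μ Y) :
    genCondExp μ m (fun x => X x + Y x) =ᵐ[μ] fun x => genCondExp μ m X x + genCondExp μ m Y x := by
  have h := genCondExp_eq_of_sub (hX.meas.add hY.meas) (hX.posPart.add hY.posPart)
    (hX.neg.posPart.add hY.neg.posPart) (fun x => by positivity) (fun x => by positivity)
    (ae_of_all _ fun x => by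
      simp only [Pi.add_apply]
      linarith [max_zero_sub_max_neg_zero (X x), max_zero_sub_max_neg_zero (Y x)])
  have e1 := condLExp_ofReal_add (m := m) (μ := μ) hX.posPart.meas
    (fun x => le_max_right _ _) (fun x => le_max_right (Y x) 0)
  have e2 := condLExp_ofReal_add (m := m) (μ := μ) hX.neg.posPart.meas
    (fun x => le_max_right _ _) (fun x => le_max_right (-Y x) 0)
  simp only [ENNReal.ofReal_max_zero] at e1 e2
  refine h.trans ?_
  filter_upwards [e1, e2, hX.pos_lt_top, hX.neg.pos_lt_top, hY.pos_lt_top, hY.neg.pos_lt_top]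
    with x e1 e2 f1 f2 f3 f4
  rw [e1, e2, ENNReal.toReal_add f1.ne f3.ne, ENNReal.toReal_add f2.ne f4.ne]
  simp only [genCondExp]
  ring

theorem condLExp_ofReal_mul [IsFiniteMeasure μ] (hm : m ≤ mΩ) {g X : Ω → ℝ}
    (hg : Measurable[m] g) (hg0 : ∀ x, 0 ≤ g x) (hX : Measurable X) :
    condLExp m μ (fun x => ENNReal.ofReal (g x * X x)) =ᵐ[μ] fun x =>
      ENNReal.ofReal (g x) * condLExp m μ (fun x => ENNReal.ofReal (X x)) x := by
  simp_rw [ENNReal.ofReal_mul (hg0 _)]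
  exact condLExp_mul_left hm (ENNReal.measurable_ofReal.comp hg) (by fun_prop)

/-- The decomposition used is gX = (g⁺X⁺ + g⁻X⁻) - (g⁺X⁻ + g⁻X⁺), whose four products have
nonnegative factors. -/
theorem genCondExp_mul_left [IsFiniteMeasure μ] (hm : m ≤ mΩ) {g X : Ω → ℝ}
    (hg : Measurable[m] g) (hX : IsCondInt m μ X) :
    genCondExp μ m (fun x => g x * X x) =ᵐ[μ] fun x => g x * genCondExp μ m X x := by
  have hgp : Measurable[m] fun x => max (g x) 0 := hg.max measurable_const
  have hgn : Measurable[m] fun x => max (-g x) 0 := hg.neg.max measurable_const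
  have i1 := hX.posPart.mul_left hm hgp
  have i2 := hX.neg.posPart.mul_left hm hgn
  have i3 := hX.neg.posPart.mul_left hm hgp
  have i4 := hX.posPart.mul_left hm hgn
  have h := genCondExp_eq_of_sub ((hg.mono hm le_rfl).mul hX.meas) (i1.add i2) (i3.add i4)
    (fun x => by positivity) (fun x => by positivity) (ae_of_all _ fun x => by
      simp only [Pi.mul_apply]
      conv_lhs => rw [← max_zero_sub_max_neg_zero (X x), ← max_zero_sub_max_neg_zero (g x)]
      ring)
  have e1 := condLExp_ofReal_add (m := m) (μ := μ) i1.meas (fun x => by positivity)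
    (V := fun x => max (-g x) 0 * max (-X x) 0) (fun x => by positivity)
  have e2 := condLExp_ofReal_add (m := m) (μ := μ) i3.meas (fun x => by positivity)
    (V := fun x => max (-g x) 0 * max (X x) 0) (fun x => by positivity)
  have k1 := condLExp_ofReal_mul (μ := μ) hm hgp (fun x => le_max_right _ _) hX.posPart.meas
  have k2 := condLExp_ofReal_mul (μ := μ) hm hgn (fun x => le_max_right _ _) hX.neg.posPart.meas
  have k3 := condLExp_ofReal_mul (μ := μ) hm hgp (fun x => le_max_right _ _) hX.neg.posPart.meas
  have k4 := condLExp_ofReal_mul (μ := μ) hm hgn (fun x => le_max_right _ _) hX.posPart.meas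
  refine h.trans ?_
  filter_upwards [e1, e2, k1, k2, k3, k4, hX.pos_lt_top, hX.neg.pos_lt_top]
    with x e1 e2 k1 k2 k3 k4 f1 f2
  rw [e1, e2, k1, k2, k3, k4]
  simp only [ENNReal.ofReal_max_zero (X _), ENNReal.ofReal_max_zero (-X _)]
  have n1 := fun r : ℝ => (ENNReal.mul_lt_top (ENNReal.ofReal_lt_top (r := r)) f1).ne
  have n2 := fun r : ℝ => (ENNReal.mul_lt_top (ENNReal.ofReal_lt_top (r := r)) f2).ne
  rw [ENNReal.toReal_add (n1 _) (n2 _), ENNReal.toReal_add (n2 _) (n1 _)]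
  simp only [ENNReal.toReal_mul, ENNReal.toReal_ofReal (le_max_right (g x) 0),
    ENNReal.toReal_ofReal (le_max_right (-g x) 0), genCondExp]
  conv_rhs => rw [← max_zero_sub_max_neg_zero (g x)]
  ring

theorem genCondExp_zero : genCondExp μ m (fun _ => (0 : ℝ)) = fun _ => 0 := by
  have : condLExp m μ (fun _ => (0 : ℝ≥0∞)) = 0 := condLExp_zero μ
  funext x
  simp [genCondExp, this]

theorem genCondExp_neg (X : Ω → ℝ) :
    genCondExp μ m (fun x => -X x) = fun x => -genCondExp μ m X x := by
  funext x
  simp [genCondExp]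

theorem genCondExp_sub {X Y : Ω → ℝ} (hX : IsCondInt m μ X) (hY : IsCondInt m μ Y) :
    genCondExp μ m (fun x => X x - Y x) =ᵐ[μ] fun x => genCondExp μ m X x - genCondExp μ m Y x := by
  have := genCondExp_add hX hY.neg
  simpa only [genCondExp_neg, ← sub_eq_add_neg] using this

theorem genCondExp_sum {ι : Type*} (s : Finset ι) {X : ι → Ω → ℝ}
    (h : ∀ i ∈ s, IsCondInt m μ (X i)) :
    genCondExp μ m (fun x => ∑ i ∈ s, X i x) =ᵐ[μ] fun x => ∑ i ∈ s, genCondExp μ m (X i) x := by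
  classical
  induction s using Finset.induction_on with
  | empty => simp [genCondExp_zero]
  | insert i s hi ih =>
    simp only [Finset.sum_insert hi]
    have h' : ∀ j ∈ s, IsCondInt m μ (X j) := fun j hj => h j (by simp [hj])
    filter_upwards [genCondExp_add (h i (by simp)) (IsCondInt.sum s h'), ih h'] with x h1 h2
    rw [h1, h2]

theorem genCondExp_nonneg {X : Ω → ℝ} (h : ∀ᵐ x ∂μ, 0 ≤ X x) :
    ∀ᵐ x ∂μ, 0 ≤ genCondExp μ m X x := by
  have h0 : condLExp m μ (fun _ => (0 : ℝ≥0∞)) = 0 := condLExp_zero μ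
  have h2 := condLExp_congr_ae (mΩ := m) (P := μ) (X := fun x => ENNReal.ofReal (-X x))
    (Y := fun _ => 0) (by
      filter_upwards [h] with x hx
      rw [ENNReal.ofReal_of_nonpos (by linarith)])
  filter_upwards [h2] with x h2
  simp [genCondExp, h2, h0]

/-- For nonnegative functions the two conditional expectations agree. -/
theorem condLExp_ofReal_eq {X : Ω → ℝ} (hX : IsCondInt m μ X) (h : ∀ᵐ x ∂μ, 0 ≤ X x) :
    condLExp m μ (fun x => ENNReal.ofReal (X x)) =ᵐ[μ] fun x =>
      ENNReal.ofReal (genCondExp μ m X x) := by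
  have h0 : condLExp m μ (fun _ => (0 : ℝ≥0∞)) = 0 := condLExp_zero μ
  have h2 := condLExp_congr_ae (mΩ := m) (P := μ) (X := fun x => ENNReal.ofReal (-X x))
    (Y := fun _ => 0) (by
      filter_upwards [h] with x hx
      rw [ENNReal.ofReal_of_nonpos (by linarith)])
  filter_upwards [h2, hX.pos_lt_top] with x h2 h3
  simp [genCondExp, h2, h0, ENNReal.ofReal_toReal h3.ne]

theorem lintegral_ofReal_genCondExp [IsFiniteMeasure μ] (hm : m ≤ mΩ) {X : Ω → ℝ}
    (hX : IsCondInt m μ X) (h : ∀ᵐ x ∂μ, 0 ≤ X x) :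
    ∫⁻ x, ENNReal.ofReal (genCondExp μ m X x) ∂μ = ∫⁻ x, ENNReal.ofReal (X x) ∂μ := by
  rw [← lintegral_congr_ae (condLExp_ofReal_eq hX h), lintegral_condLExp hm]

theorem ae_eq_zero_of_genCondExp_eq_zero [IsFiniteMeasure μ] (hm : m ≤ mΩ) {X : Ω → ℝ}
    (hX : IsCondInt m μ X) (h : ∀ᵐ x ∂μ, 0 ≤ X x) (h0 : ∀ᵐ x ∂μ, genCondExp μ m X x = 0) :
    ∀ᵐ x ∂μ, X x = 0 := by
  have h1 := lintegral_ofReal_genCondExp hm hX h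
  rw [lintegral_congr_ae (g := fun _ => 0) (by filter_upwards [h0] with x hx; simp [hx]),
    lintegral_zero, eq_comm, lintegral_eq_zero_iff' (by have := hX.meas; fun_prop)] at h1
  filter_upwards [h, h1] with x hx h1
  exact le_antisymm (ENNReal.ofReal_eq_zero.1 h1) hx

/-- By the tower property in [0, ∞], conditioning E[X⁺ | m'] on m gives E[X⁺ | m], which is finite.
Applied to X and -X, this makes the two halves of `genCondExp μ m' X` a valid decomposition. -/
theorem IsCondInt.genCondExp [IsFiniteMeasure μ] (hmm : m ≤ m')
    (hm : m' ≤ mΩ) {X : Ω → ℝ} (hX : IsCondInt m μ X) (hX' : IsCondInt m' μ X) :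
    IsCondInt m μ fun x => (condLExp m' μ (fun y => ENNReal.ofReal (X y)) x).toReal := by
  refine ⟨((measurable_condLExp' m' μ _)).ennreal_toReal, ?_⟩
  unfold CondIntegrable
  have h1 := condLExp_congr_ae (mΩ := m) (P := μ)
    (X := fun x => ENNReal.ofReal |(condLExp m' μ (fun y => ENNReal.ofReal (X y)) x).toReal|)
    (Y := condLExp m' μ (fun y => ENNReal.ofReal (X y))) (by
      filter_upwards [hX'.pos_lt_top] with x hx
      rw [abs_of_nonneg ENNReal.toReal_nonneg, ENNReal.ofReal_toReal hx.ne])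
  filter_upwards [h1, condLExp_condLExp_of_le hmm hm (μ := μ) (fun y => ENNReal.ofReal (X y)),
    hX.pos_lt_top] with x h1 h2 h3
  rwa [h1, h2]

/-- Tower property of the generalised conditional expectation. -/
theorem genCondExp_genCondExp_of_le [IsFiniteMeasure μ] (hmm : m ≤ m')
    (hm : m' ≤ mΩ) {X : Ω → ℝ} (hX : IsCondInt m μ X) (hX' : IsCondInt m' μ X) :
    genCondExp μ m (genCondExp μ m' X) =ᵐ[μ] genCondExp μ m X := by
  have h := genCondExp_eq_of_sub (m := m) (μ := μ)
    (((measurable_genCondExp (μ := μ) (m := m') X)).mono hm le_rfl)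
    (hX.genCondExp hmm hm hX') (hX.neg.genCondExp hmm hm hX'.neg)
    (fun x => ENNReal.toReal_nonneg) (fun x => ENNReal.toReal_nonneg) (ae_of_all _ fun x => rfl)
  have key : ∀ Y : Ω → ℝ, IsCondInt m' μ Y → condLExp m μ (fun x => ENNReal.ofReal
      (condLExp m' μ (fun y => ENNReal.ofReal (Y y)) x).toReal) =ᵐ[μ]
      condLExp m μ (fun y => ENNReal.ofReal (Y y)) := fun Y hY =>
    (condLExp_congr_ae (by
      filter_upwards [hY.pos_lt_top] with x hx
      rw [ENNReal.ofReal_toReal hx.ne])).trans (condLExp_condLExp_of_le hmm hm _)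
  refine h.trans ?_
  filter_upwards [key X hX', key _ hX'.neg] with x h1 h2
  rw [h1, h2]
  rfl

/-- Conditioning on m' first pulls g out, so only the projections of X and Y on m' matter. This
later exchanges `sumB` with `sumA`, and `sumC` with `sumD`, behind a factor ΔS. -/
theorem genCondExp_mul_congr [IsFiniteMeasure μ] (hmm : m ≤ m')
    (hm : m' ≤ mΩ) {g X Y : Ω → ℝ} (hg : Measurable[m'] g) (hX : IsCondInt m' μ X)
    (hY : IsCondInt m' μ Y) (hgX : IsCondInt m μ fun x => g x * X x)
    (hgY : IsCondInt m μ fun x => g x * Y x)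
    (h : genCondExp μ m' X =ᵐ[μ] genCondExp μ m' Y) :
    genCondExp μ m (fun x => g x * X x) =ᵐ[μ] genCondExp μ m (fun x => g x * Y x) := by
  refine (genCondExp_genCondExp_of_le hmm hm hgX (hX.mul_left hm hg)).symm.trans
    (Filter.EventuallyEq.trans (genCondExp_congr ?_)
      (genCondExp_genCondExp_of_le hmm hm hgY (hY.mul_left hm hg)))
  filter_upwards [genCondExp_mul_left hm hg hX, genCondExp_mul_left hm hg hY, h] with x h1 h2 h3
  rw [h1, h2, h3]

theorem integral_genCondExp [IsFiniteMeasure μ] (hm : m ≤ mΩ) {X : Ω → ℝ}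
    (hX : Integrable X μ) : ∫ x, genCondExp μ m X x ∂μ = ∫ x, X x ∂μ := by
  have key : ∀ Y : Ω → ℝ, Integrable Y μ →
      Integrable (fun x => (condLExp m μ (fun y => ENNReal.ofReal (Y y)) x).toReal) μ ∧
      ∫ x, (condLExp m μ (fun y => ENNReal.ofReal (Y y)) x).toReal ∂μ =
        (∫⁻ x, ENNReal.ofReal (Y x) ∂μ).toReal := by
    intro Y hY
    have hf : ∫⁻ x, condLExp m μ (fun y => ENNReal.ofReal (Y y)) x ∂μ ≠ ∞ := by
      rw [lintegral_condLExp hm]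
      exact hY.lintegral_lt_top.ne
    refine ⟨integrable_toReal_of_lintegral_ne_top (measurable_condLExp' _ _ _).aemeasurable hf, ?_⟩
    rw [integral_toReal (measurable_condLExp' _ _ _).aemeasurable
      (ae_lt_top (measurable_condLExp' _ _ _) hf), lintegral_condLExp hm]
  rw [integral_eq_lintegral_pos_part_sub_lintegral_neg_part hX]
  unfold genCondExp
  have hn := key (fun x => -X x) hX.neg
  rw [integral_sub (key X hX).1 hn.1, (key X hX).2, hn.2]

end Toolkit

/-! ### Measurability and range of the Moore-Penrose inverse. -/

section PinvMeasurable

variable {Ω : Type*} {M : ℕ}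

theorem measurable_matrix_det [MeasurableSpace Ω] {A : Ω → Matrix (Fin M) (Fin M) ℝ}
    (hA : ∀ i j, Measurable fun x => A x i j) : Measurable fun x => (A x).det := by
  simp only [Matrix.det_apply]
  refine Finset.measurable_sum _ fun σ _ => ?_
  exact (Finset.measurable_prod _ fun i _ => hA _ _).const_smul _

theorem measurable_matrix_inv [MeasurableSpace Ω] {A : Ω → Matrix (Fin M) (Fin M) ℝ}
    (hA : ∀ i j, Measurable fun x => A x i j) (i j : Fin M) :
    Measurable fun x => (A x)⁻¹ i j := by
  simp only [Matrix.inv_def, Matrix.smul_apply, Ring.inverse_eq_inv', smul_eq_mul,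
    Matrix.adjugate_apply]
  refine (measurable_matrix_det hA).inv.mul (measurable_matrix_det fun k l => ?_)
  simp only [Matrix.updateRow_apply]
  split_ifs
  · exact measurable_const
  · exact hA k l

theorem measurable_matrix_mul [MeasurableSpace Ω] {A B : Ω → Matrix (Fin M) (Fin M) ℝ}
    (hA : ∀ i j, Measurable fun x => A x i j) (hB : ∀ i j, Measurable fun x => B x i j)
    (i j : Fin M) : Measurable fun x => (A x * B x) i j := by
  simp only [Matrix.mul_apply]
  exact Finset.measurable_sum _ fun k _ => (hA i k).mul (hB k j)

/-- Pointwise convergence on the spectrum implies entrywise convergence of the functional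
calculus. -/
theorem tendsto_cfc_matrix_apply {A : Matrix (Fin M) (Fin M) ℝ} (hA : A.IsSymm) {f : ℕ → ℝ → ℝ}
    {g : ℝ → ℝ} (h : ∀ t, Filter.Tendsto (fun k => f k t) Filter.atTop (nhds (g t)))
    (i j : Fin M) :
    Filter.Tendsto (fun k => cfc (f k) A i j) Filter.atTop (nhds (cfc g A i j)) := by
  have hH : A.IsHermitian := by
    rw [Matrix.IsHermitian, Matrix.conjTranspose_eq_transpose_of_trivial]
    exact hA
  have key : ∀ f : ℝ → ℝ, cfc f A i j = ∑ k, hH.eigenvectorUnitary.1 i k *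
      f (hH.eigenvalues k) * (star hH.eigenvectorUnitary.1) k j := by
    intro f
    rw [hH.cfc_eq, Matrix.IsHermitian.cfc, Unitary.conjStarAlgAut_apply, Matrix.mul_apply]
    simp [Matrix.mul_diagonal]
  simp only [key]
  exact tendsto_finsetSum _ fun k _ => ((h _).const_mul _).mul_const _

theorem mul_inv_sq_add_eq_cfc {A : Matrix (Fin M) (Fin M) ℝ} (hA : A.IsSymm) {ε : ℝ}
    (hε : 0 < ε) : A * (A * A + ε • (1 : Matrix (Fin M) (Fin M) ℝ))⁻¹ =
      cfc (fun t : ℝ => t * (t * t + ε)⁻¹) A := by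
  have hsa : IsSelfAdjoint A := by
    rw [isSelfAdjoint_iff, Matrix.star_eq_conjTranspose,
      Matrix.conjTranspose_eq_transpose_of_trivial]
    exact hA
  have hc := symPinv_continuousOn A
  have h1 : A * A + ε • (1 : Matrix (Fin M) (Fin M) ℝ) = cfc (fun t : ℝ => t * t + ε) A := by
    rw [cfc_add A (fun t : ℝ => t * t) (fun _ => ε) (hc _) (hc _),
      cfc_mul (fun t : ℝ => t) (fun t => t) A (hc _) (hc _), cfc_id' ℝ A, cfc_const ε A,
      Algebra.algebraMap_eq_smul_one]
  have h2 : cfc (fun t : ℝ => (t * t + ε)⁻¹) A * (A * A + ε • 1) = 1 := by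
    rw [h1, ← cfc_mul (fun t : ℝ => (t * t + ε)⁻¹) (fun t => t * t + ε) A (hc _) (hc _)]
    have : (fun t : ℝ => (t * t + ε)⁻¹ * (t * t + ε)) = fun _ => 1 := by
      funext t
      exact inv_mul_cancel₀ (by nlinarith [mul_self_nonneg t])
    rw [this, cfc_const_one ℝ A]
  rw [Matrix.inv_eq_left_inv h2,
    cfc_mul (fun t : ℝ => t) (fun t : ℝ => (t * t + ε)⁻¹) A (hc _) (hc _), cfc_id' ℝ A]

/-- The Moore-Penrose inverse is not continuous, but it is the limit of A (A² + ε)⁻¹ as ε ↓ 0: on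
eigenvalues, t / (t² + ε) tends to t⁻¹ if t ≠ 0 and stays 0 if t = 0. The approximants are rational
in the entries of A. -/
theorem measurable_symPinv [MeasurableSpace Ω] {A : Ω → Matrix (Fin M) (Fin M) ℝ}
    (hA : ∀ i j, Measurable fun x => A x i j) (hs : ∀ x, (A x).IsSymm) (i j : Fin M) :
    Measurable fun x => symPinv (A x) i j := by
  have hpos : ∀ k : ℕ, (0 : ℝ) < 1 / ((k : ℝ) + 1) := fun k => by positivity
  refine measurable_of_tendsto_metrizable (f := fun (k : ℕ) x =>
    (A x * (A x * A x + (1 / ((k : ℝ) + 1)) • (1 : Matrix (Fin M) (Fin M) ℝ))⁻¹) i j)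
    (fun k => ?_) (tendsto_pi_nhds.2 fun x => ?_)
  · refine measurable_matrix_mul hA (measurable_matrix_inv fun i j => ?_) i j
    simp only [Matrix.add_apply]
    exact (measurable_matrix_mul hA hA i j).add measurable_const
  · simp only [mul_inv_sq_add_eq_cfc (hs x) (hpos _)]
    refine tendsto_cfc_matrix_apply (hs x) (fun t => ?_) i j
    by_cases ht : t = 0
    · simp [ht]
    · have h0 := tendsto_one_div_add_atTop_nhds_zero_nat (𝕜 := ℝ)
      have h1 := ((h0.const_add (t * t)).inv₀ (by simp [ht])).const_mul t
      convert h1 using 2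
      field_simp
      simp

theorem measurable_mulVec [MeasurableSpace Ω] {A : Ω → Matrix (Fin M) (Fin M) ℝ}
    {v : Ω → Fin M → ℝ} (hA : ∀ i j, Measurable fun x => A x i j) (hv : Measurable v) :
    Measurable fun x => A x *ᵥ v x := by
  refine measurable_pi_lambda _ fun i => ?_
  simp only [Matrix.mulVec, dotProduct]
  exact Finset.measurable_sum _ fun k _ => (hA i k).mul ((measurable_pi_apply k).comp hv)

theorem measurable_dotProduct [MeasurableSpace Ω] {u v : Ω → Fin M → ℝ} (hu : Measurable u)
    (hv : Measurable v) : Measurable fun x => u x ⬝ᵥ v x := by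
  simp only [dotProduct]
  exact Finset.measurable_sum _ fun k _ =>
    ((measurable_pi_apply k).comp hu).mul ((measurable_pi_apply k).comp hv)

/-- A vector orthogonal to the kernel of a symmetric matrix is in its range, and the
Moore-Penrose inverse yields a preimage. It suffices to test with one vector of the kernel. -/
theorem mulVec_symPinv_mulVec {A : Matrix (Fin M) (Fin M) ℝ} (hA : A.IsSymm) {b : Fin M → ℝ}
    (h : (b - (A * symPinv A) *ᵥ b) ⬝ᵥ b = 0) : A *ᵥ (symPinv A *ᵥ b) = b := by
  obtain ⟨h1, -, h3, -⟩ := symPinv_penrose hA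
  set E := A * symPinv A
  have hE : E * E = E := by rw [← Matrix.mul_assoc, h1]
  -- E is an orthogonal projection, so b - Eb is orthogonal to Eb; together with `h` this gives |b -
  -- Eb|² = 0.
  have h0 : (b - E *ᵥ b) ⬝ᵥ (E *ᵥ b) = 0 := by
    rw [Matrix.dotProduct_mulVec, ← Matrix.mulVec_transpose, h3, Matrix.mulVec_sub,
      Matrix.mulVec_mulVec, hE, sub_self, zero_dotProduct]
  have h4 : b - E *ᵥ b = 0 := by
    rw [← dotProduct_self_eq_zero, dotProduct_sub, h, h0, sub_zero]
  rw [Matrix.mulVec_mulVec]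
  exact (sub_eq_zero.1 h4).symm

/-- The test vector of `mulVec_symPinv_mulVec` is in the kernel. -/
theorem mulVec_sub_symPinv_eq_zero {A : Matrix (Fin M) (Fin M) ℝ} (hA : A.IsSymm)
    (b : Fin M → ℝ) : A *ᵥ (b - (A * symPinv A) *ᵥ b) = 0 := by
  obtain ⟨h1, -, h3, -⟩ := symPinv_penrose hA
  have : A * (A * symPinv A) = A := by
    have := congrArg Matrix.transpose h1
    rw [Matrix.transpose_mul, h3, hA] at this
    exact this
  rw [Matrix.mulVec_sub, Matrix.mulVec_mulVec, this, sub_self]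

end PinvMeasurable

/-! ### Conditional least squares and its normal equations. -/

section CondMoment

variable {Ω : Type*} {m : MeasurableSpace Ω} [mΩ : MeasurableSpace Ω] {μ : Measure Ω} {M : ℕ}
  {X : Ω → Fin M → ℝ} {A D : Ω → ℝ}

/-- The conditional second moment matrix `E[X Xᵀ A | m]`. -/
noncomputable def condMoment {Ω : Type*} {M : ℕ} (m : MeasurableSpace Ω)
    [mΩ : MeasurableSpace Ω] (μ : Measure Ω) (X : Ω → Fin M → ℝ) (A : Ω → ℝ) (x : Ω) :
    Matrix (Fin M) (Fin M) ℝ :=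
  Matrix.of fun a b => genCondExp μ m (fun y => X y a * X y b * A y) x

theorem condMoment_isSymm (x : Ω) : (condMoment m μ X A x).IsSymm := by
  ext a b
  simp only [condMoment, Matrix.transpose_apply, Matrix.of_apply, mul_comm (X _ b)]

theorem measurable_condMoment (a b : Fin M) :
    Measurable[m] fun x => condMoment m μ X A x a b :=
  measurable_genCondExp _

theorem measurable_genCondExp_vec :
    Measurable[m] fun x (a : Fin M) => genCondExp μ m (fun y => X y a * D y) x :=
  @measurable_pi_lambda _ _ _ m _ _ fun _ => measurable_genCondExp _

end CondMoment

section OneStep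

variable {Ω : Type*} {m : MeasurableSpace Ω} [mΩ : MeasurableSpace Ω] {μ : Measure Ω}
  [IsFiniteMeasure μ] {M : ℕ}

theorem IsCondInt.dotProduct (hm : m ≤ mΩ) {u : Ω → Fin M → ℝ} (hu : Measurable[m] u)
    {Y : Fin M → Ω → ℝ} (hY : ∀ a, IsCondInt m μ (Y a)) :
    IsCondInt m μ fun x => u x ⬝ᵥ fun a => Y a x :=
  IsCondInt.sum _ fun a _ => (hY a).mul_left hm ((measurable_pi_apply a).comp hu)

theorem genCondExp_dotProduct (hm : m ≤ mΩ) {u : Ω → Fin M → ℝ} (hu : Measurable[m] u)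
    {Y : Fin M → Ω → ℝ} (hY : ∀ a, IsCondInt m μ (Y a)) :
    genCondExp μ m (fun x => u x ⬝ᵥ fun a => Y a x) =ᵐ[μ] fun x =>
      u x ⬝ᵥ fun a => genCondExp μ m (Y a) x := by
  have hu' : ∀ a, Measurable[m] fun x => u x a := fun a => (measurable_pi_apply a).comp hu
  have h1 := genCondExp_sum (m := m) (μ := μ) Finset.univ (X := fun a x => u x a * Y a x)
    fun a _ => (hY a).mul_left hm (hu' a)
  have h2 : ∀ᵐ x ∂μ, ∀ a, genCondExp μ m (fun x => u x a * Y a x) x =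
      u x a * genCondExp μ m (Y a) x :=
    ae_all_iff.2 fun a => genCondExp_mul_left hm (hu' a) (hY a)
  refine h1.trans ?_
  filter_upwards [h2] with x h2
  exact Finset.sum_congr rfl fun a _ => h2 a

variable {X : Ω → Fin M → ℝ} {A D q : Ω → ℝ}

theorem dotProduct_mul_eq (u v : Fin M → ℝ) (d : ℝ) :
    (u ⬝ᵥ v) * d = u ⬝ᵥ fun a => v a * d := by
  simp only [dotProduct, Finset.sum_mul, mul_assoc]

theorem IsCondInt.dotProduct_mul (hm : m ≤ mΩ) {u : Ω → Fin M → ℝ} (hu : Measurable[m] u)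
    (hXD : ∀ a, IsCondInt m μ fun x => X x a * D x) :
    IsCondInt m μ fun x => (u x ⬝ᵥ X x) * D x := by
  simp only [dotProduct_mul_eq]
  exact IsCondInt.dotProduct hm hu hXD

theorem genCondExp_dotProduct_mul (hm : m ≤ mΩ) {u : Ω → Fin M → ℝ} (hu : Measurable[m] u)
    (hXD : ∀ a, IsCondInt m μ fun x => X x a * D x) :
    genCondExp μ m (fun x => (u x ⬝ᵥ X x) * D x) =ᵐ[μ] fun x =>
      u x ⬝ᵥ fun a => genCondExp μ m (fun y => X y a * D y) x := by
  have h := genCondExp_dotProduct hm hu hXD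
  simpa only [dotProduct_mul_eq] using h

theorem IsCondInt.mul_dotProduct_mul (hm : m ≤ mΩ) {v : Ω → Fin M → ℝ} (hv : Measurable[m] v)
    (hXX : ∀ a b, IsCondInt m μ fun x => X x a * X x b * A x) (a : Fin M) :
    IsCondInt m μ fun x => X x a * ((v x ⬝ᵥ X x) * A x) := by
  have := IsCondInt.dotProduct hm hv (hXX a)
  convert this using 1
  funext x
  simp only [_root_.dotProduct, Finset.sum_mul, Finset.mul_sum]
  exact Finset.sum_congr rfl fun b _ => by ring

theorem genCondExp_mul_dotProduct_mul (hm : m ≤ mΩ) {v : Ω → Fin M → ℝ} (hv : Measurable[m] v)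
    (hXX : ∀ a b, IsCondInt m μ fun x => X x a * X x b * A x) :
    ∀ᵐ x ∂μ, (fun a => genCondExp μ m (fun y => X y a * ((v y ⬝ᵥ X y) * A y)) x) =
      condMoment m μ X A x *ᵥ v x := by
  have : ∀ᵐ x ∂μ, ∀ a, genCondExp μ m (fun y => X y a * ((v y ⬝ᵥ X y) * A y)) x =
      v x ⬝ᵥ fun b => genCondExp μ m (fun y => X y a * X y b * A y) x := by
    refine ae_all_iff.2 fun a => ?_
    have h := genCondExp_dotProduct hm hv (hXX a)
    have e : (fun x => v x ⬝ᵥ fun b => X x a * X x b * A x) =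
        fun y => X y a * ((v y ⬝ᵥ X y) * A y) := by
      funext x
      simp only [dotProduct, Finset.sum_mul, Finset.mul_sum]
      exact Finset.sum_congr rfl fun b _ => by ring
    rwa [e] at h
  filter_upwards [this] with x h
  funext a
  rw [h a, dotProduct_comm]
  rfl

theorem IsCondInt.dotProduct_mul_dotProduct_mul (hm : m ≤ mΩ) {u v : Ω → Fin M → ℝ}
    (hu : Measurable[m] u) (hv : Measurable[m] v)
    (hXX : ∀ a b, IsCondInt m μ fun x => X x a * X x b * A x) :
    IsCondInt m μ fun x => (u x ⬝ᵥ X x) * ((v x ⬝ᵥ X x) * A x) :=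
  IsCondInt.dotProduct_mul hm hu (IsCondInt.mul_dotProduct_mul hm hv hXX)

theorem genCondExp_dotProduct_mul_dotProduct_mul (hm : m ≤ mΩ) {u v : Ω → Fin M → ℝ}
    (hu : Measurable[m] u) (hv : Measurable[m] v)
    (hXX : ∀ a b, IsCondInt m μ fun x => X x a * X x b * A x) :
    genCondExp μ m (fun x => (u x ⬝ᵥ X x) * ((v x ⬝ᵥ X x) * A x)) =ᵐ[μ] fun x =>
      u x ⬝ᵥ (condMoment m μ X A x *ᵥ v x) := by
  filter_upwards [genCondExp_dotProduct_mul hm hu (IsCondInt.mul_dotProduct_mul hm hv hXX),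
    genCondExp_mul_dotProduct_mul hm hv hXX] with x h1 h2
  rw [h1, h2]

/-- Solvability of the conditional normal equations. -/
theorem condMoment_mulVec_symPinv (hm : m ≤ mΩ)
    (hXX : ∀ a b, IsCondInt m μ fun x => X x a * X x b * A x) (hA : ∀ᵐ x ∂μ, 0 ≤ A x)
    (hXD : ∀ a, IsCondInt m μ fun x => X x a * D x) (hAD : ∀ᵐ x ∂μ, A x = 0 → D x = 0) :
    ∀ᵐ x ∂μ, condMoment m μ X A x *ᵥ (symPinv (condMoment m μ X A x) *ᵥ
      fun a => genCondExp μ m (fun y => X y a * D y) x) =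
      fun a => genCondExp μ m (fun y => X y a * D y) x := by
  set b : Ω → Fin M → ℝ := fun x a => genCondExp μ m (fun y => X y a * D y) x with hb
  set v : Ω → Fin M → ℝ := fun x =>
    b x - (condMoment m μ X A x * symPinv (condMoment m μ X A x)) *ᵥ b x with hv
  have hbm : Measurable[m] b := measurable_genCondExp_vec
  have hvm : Measurable[m] v := by
    refine hbm.sub (@measurable_mulVec _ _ m _ _ (fun i j => ?_) hbm)
    exact @measurable_matrix_mul _ _ m _ _ (fun i j => measurable_condMoment i j)
      (fun i j => @measurable_symPinv _ _ m _ (fun i j => measurable_condMoment i j)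
        (fun x => condMoment_isSymm x) i j) i j
  -- The vector v is in the kernel of the moment matrix, so E[(vᵀX)² A | m] = 0 and the nonnegative
  -- (vᵀX)² A vanishes almost surely.
  have h0 := ae_eq_zero_of_genCondExp_eq_zero hm
    (IsCondInt.dotProduct_mul_dotProduct_mul hm hvm hvm hXX) (by
      filter_upwards [hA] with x hx
      rw [← mul_assoc]
      exact mul_nonneg (mul_self_nonneg _) hx) (by
      filter_upwards [genCondExp_dotProduct_mul_dotProduct_mul hm hvm hvm hXX] with x h
      rw [h, hv]
      simp only [mulVec_sub_symPinv_eq_zero (condMoment_isSymm x), dotProduct_zero])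
  -- Where vᵀX ≠ 0 the weight A is zero, hence D is zero. Conditioning on m yields vᵀb = 0, the
  -- single test required by `mulVec_symPinv_mulVec`.
  have h1 : (fun x => (v x ⬝ᵥ X x) * D x) =ᵐ[μ] fun _ => 0 := by
    filter_upwards [h0, hAD] with x h0 hAD
    rcases mul_eq_zero.1 h0 with h | h
    · rw [h, zero_mul]
    rcases mul_eq_zero.1 h with h | h
    · rw [h, zero_mul]
    · rw [hAD h, mul_zero]
  filter_upwards [genCondExp_dotProduct_mul hm hvm hXD, genCondExp_congr (m := m) h1] with x h2 h3
  rw [genCondExp_zero] at h3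
  exact mulVec_symPinv_mulVec (condMoment_isSymm x) (h2.symm.trans h3)

theorem IsCondInt.const_mul (hm : m ≤ mΩ) (c : ℝ) {Y : Ω → ℝ} (hY : IsCondInt m μ Y) :
    IsCondInt m μ fun x => c * Y x :=
  hY.mul_left hm measurable_const

theorem IsCondInt.quadratic (hm : m ≤ mΩ) {φ : Ω → Fin M → ℝ} (hφ : Measurable[m] φ)
    (hXX : ∀ a b, IsCondInt m μ fun x => X x a * X x b * A x)
    (hXD : ∀ a, IsCondInt m μ fun x => X x a * D x) (hq : IsCondInt m μ q) :
    IsCondInt m μ fun x => (φ x ⬝ᵥ X x) ^ 2 * A x - 2 * (φ x ⬝ᵥ X x) * D x + q x := by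
  have := ((IsCondInt.dotProduct_mul_dotProduct_mul hm hφ hφ hXX).sub
    ((IsCondInt.dotProduct_mul hm hφ hXD).const_mul hm 2)).add hq
  convert this using 2 with x
  ring

/-- A solution of the conditional normal equations minimises the conditional expectation of a
random quadratic function. -/
theorem genCondExp_quadratic_le (hm : m ≤ mΩ) {φ ψ : Ω → Fin M → ℝ} (hφ : Measurable[m] φ)
    (hψ : Measurable[m] ψ) (hXX : ∀ a b, IsCondInt m μ fun x => X x a * X x b * A x)
    (hA : ∀ᵐ x ∂μ, 0 ≤ A x) (hXD : ∀ a, IsCondInt m μ fun x => X x a * D x)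
    (hq : IsCondInt m μ q)
    (hn : ∀ᵐ x ∂μ, condMoment m μ X A x *ᵥ ψ x =
      fun a => genCondExp μ m (fun y => X y a * D y) x) :
    ∀ᵐ x ∂μ, genCondExp μ m
        (fun x => (ψ x ⬝ᵥ X x) ^ 2 * A x - 2 * (ψ x ⬝ᵥ X x) * D x + q x) x ≤
      genCondExp μ m (fun x => (φ x ⬝ᵥ X x) ^ 2 * A x - 2 * (φ x ⬝ᵥ X x) * D x + q x) x := by
  have hu : Measurable[m] fun x => φ x - ψ x := hφ.sub hψ
  have i1 := IsCondInt.quadratic hm hψ hXX hXD hq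
  have i2 := IsCondInt.dotProduct_mul_dotProduct_mul hm hu hu hXX
  have i3 := IsCondInt.dotProduct_mul_dotProduct_mul hm hu hψ hXX
  have i4 := IsCondInt.dotProduct_mul hm hu hXD
  -- Expansion around ψ: the normal equations kill the conditional expectation of the cross term,
  -- and the square of (φ - ψ)ᵀX weighted by A remains.
  have e : (fun x => (φ x ⬝ᵥ X x) ^ 2 * A x - 2 * (φ x ⬝ᵥ X x) * D x + q x) = fun x =>
      ((ψ x ⬝ᵥ X x) ^ 2 * A x - 2 * (ψ x ⬝ᵥ X x) * D x + q x) +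
      (((φ x - ψ x) ⬝ᵥ X x) * (((φ x - ψ x) ⬝ᵥ X x) * A x) +
      2 * (((φ x - ψ x) ⬝ᵥ X x) * ((ψ x ⬝ᵥ X x) * A x) - ((φ x - ψ x) ⬝ᵥ X x) * D x)) := by
    funext x
    rw [sub_dotProduct]
    ring
  rw [e]
  filter_upwards [genCondExp_add i1 (i2.add ((i3.sub i4).const_mul hm 2)),
    genCondExp_add i2 ((i3.sub i4).const_mul hm 2),
    genCondExp_mul_left hm (measurable_const (a := (2 : ℝ))) (i3.sub i4),
    genCondExp_sub i3 i4, genCondExp_nonneg (m := m) (μ := μ) (X := fun x =>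
      ((φ x - ψ x) ⬝ᵥ X x) * (((φ x - ψ x) ⬝ᵥ X x) * A x)) (by
        filter_upwards [hA] with x hx
        rw [← mul_assoc]
        exact mul_nonneg (mul_self_nonneg _) hx),
    genCondExp_dotProduct_mul_dotProduct_mul hm hu hψ hXX, genCondExp_dotProduct_mul hm hu hXD, hn]
    with x h1 h2 h3 h4 h5 h6 h7 h8
  rw [h1, h2, h3, h4, h6, h7, h8]
  linarith

/-- This is the [0, ∞]-valued form, which can be integrated even when the cost of φ is infinite. In
`h0` the null set does not depend on y, so the random values φᵀX and ψᵀX may be substituted and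
`ENNReal.ofReal` truncates nothing. -/
theorem condLExp_quadratic_le (hm : m ≤ mΩ) {φ ψ : Ω → Fin M → ℝ} (hφ : Measurable[m] φ)
    (hψ : Measurable[m] ψ) (hXX : ∀ a b, IsCondInt m μ fun x => X x a * X x b * A x)
    (hA : ∀ᵐ x ∂μ, 0 ≤ A x) (hXD : ∀ a, IsCondInt m μ fun x => X x a * D x)
    (hq : IsCondInt m μ q) (h0 : ∀ᵐ x ∂μ, ∀ y : ℝ, 0 ≤ y ^ 2 * A x - 2 * y * D x + q x)
    (hn : ∀ᵐ x ∂μ, condMoment m μ X A x *ᵥ ψ x =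
      fun a => genCondExp μ m (fun y => X y a * D y) x) :
    condLExp m μ (fun x => ENNReal.ofReal
        ((ψ x ⬝ᵥ X x) ^ 2 * A x - 2 * (ψ x ⬝ᵥ X x) * D x + q x)) ≤ᵐ[μ]
      condLExp m μ (fun x => ENNReal.ofReal
        ((φ x ⬝ᵥ X x) ^ 2 * A x - 2 * (φ x ⬝ᵥ X x) * D x + q x)) := by
  filter_upwards [genCondExp_quadratic_le hm hφ hψ hXX hA hXD hq hn,
    condLExp_ofReal_eq (IsCondInt.quadratic hm hφ hXX hXD hq)
      (by filter_upwards [h0] with x h using h _),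
    condLExp_ofReal_eq (IsCondInt.quadratic hm hψ hXX hXD hq)
      (by filter_upwards [h0] with x h using h _)]
    with x h1 h2 h3
  rw [h2, h3]
  exact ENNReal.ofReal_le_ofReal h1

end OneStep

/-! ### Integrability from a conditional bound and from weighted Young inequalities. -/

section Bounds

variable {Ω : Type*} {m m' : MeasurableSpace Ω} [mΩ : MeasurableSpace Ω] {μ : Measure Ω}
  [IsFiniteMeasure μ]

/-- Conditioning on m' first gives E[YA | m'] = Y E[A | m'] ≤ KY, and Y is conditionally integrable
given m. With Y a squared price increment, local square integrability suffices. -/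
theorem IsCondInt.mul_of_condLExp_le (hmm : m ≤ m') (hm : m' ≤ mΩ) {Y A : Ω → ℝ}
    (hY : Measurable[m'] Y) (hY0 : ∀ x, 0 ≤ Y x) (hYi : CondIntegrable μ m Y) (hA : Measurable A)
    (hA0 : ∀ᵐ x ∂μ, 0 ≤ A x) {K : ℝ≥0∞} (hK : K ≠ ∞)
    (hAK : ∀ᵐ x ∂μ, condLExp m' μ (fun x => ENNReal.ofReal (A x)) x ≤ K) :
    IsCondInt m μ fun x => Y x * A x := by
  refine ⟨(hY.mono hm le_rfl).mul hA, ?_⟩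
  have hYm : Measurable Y := hY.mono hm le_rfl
  have e1 := condLExp_congr_ae (mΩ := m) (P := μ) (X := fun x => ENNReal.ofReal |Y x * A x|)
    (Y := fun x => ENNReal.ofReal (Y x * A x)) (by
      filter_upwards [hA0] with x h
      rw [abs_of_nonneg (mul_nonneg (hY0 x) h)])
  have e2 := condLExp_condLExp_of_le hmm hm (μ := μ) (fun x => ENNReal.ofReal (Y x * A x))
  have e3 := condLExp_mono (mΩ := m) (P := μ)
    (X := condLExp m' μ fun x => ENNReal.ofReal (Y x * A x))
    (Y := fun x => K * ENNReal.ofReal (Y x)) (by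
      filter_upwards [condLExp_ofReal_mul hm hY hY0 hA, hAK] with x h1 h2
      rw [h1, mul_comm]
      gcongr)
  have e4 := condLExp_mul_left (μ := μ) (hmm.trans hm) (Y := fun _ => K)
    (X := fun x => ENNReal.ofReal (Y x)) measurable_const (by fun_prop)
  filter_upwards [e1, e2, e3, e4, hYi] with x e1 e2 e3 e4 h
  rw [e1, ← e2]
  refine e3.trans_lt ?_
  rw [e4]
  simp only [abs_of_nonneg (hY0 _)] at h
  exact ENNReal.mul_lt_top hK.lt_top h

/-- Termwise this is |u (rv)| ≤ (rv)² + u², weighted by w. The factor r lands only on the sum of the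
w v², the role played by `sumA`. -/
theorem abs_mul_sum_le {ι : Type*} (s : Finset ι) {w : ι → ℝ} (hw : ∀ i ∈ s, 0 ≤ w i)
    (u v : ι → ℝ) (r : ℝ) :
    |r * ∑ i ∈ s, w i * u i * v i| ≤ r ^ 2 * ∑ i ∈ s, w i * v i ^ 2 + ∑ i ∈ s, w i * u i ^ 2 := by
  rw [Finset.mul_sum, Finset.mul_sum, ← Finset.sum_add_distrib]
  refine (Finset.abs_sum_le_sum_abs _ _).trans (Finset.sum_le_sum fun i hi => ?_)
  have h : |u i * (r * v i)| ≤ (r * v i) ^ 2 + u i ^ 2 := by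
    rw [abs_le]
    constructor <;> nlinarith [sq_nonneg (r * v i + u i), sq_nonneg (r * v i - u i),
      sq_nonneg (r * v i), sq_nonneg (u i)]
  calc |r * (w i * u i * v i)| = w i * |u i * (r * v i)| := by
        rw [← abs_of_nonneg (hw i hi), ← abs_mul, abs_of_nonneg (hw i hi)]
        congr 1; ring
    _ ≤ w i * ((r * v i) ^ 2 + u i ^ 2) := mul_le_mul_of_nonneg_left h (hw i hi)
    _ = _ := by ring

end Bounds

/-! ### The tail sums, their backward recursions and measurability. -/

namespace HedgingProblem

variable {Ω : Type*} [mΩ : MeasurableSpace Ω] {M : ℕ} (P : HedgingProblem Ω M) (μ : Measure Ω)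

/-- Standing assumptions: adapted locally square integrable prices, adapted weights in `[0, 1]`,
adapted square integrable claims. -/
structure IsRegular : Prop where
  measurable_S : ∀ n ≤ P.N, Measurable[P.filt n] (P.S n)
  condIntegrable_dS : ∀ n, 1 ≤ n → n ≤ P.N → ∀ a : Fin M,
    CondIntegrable μ (P.filt (n - 1)) (fun x => P.dS n x a ^ 2)
  measurable_w : ∀ n ≤ P.N, Measurable[P.filt n] (P.w n)
  w_mem : ∀ n ≤ P.N, ∀ᵐ x ∂μ, P.w n x ∈ Set.Icc (0 : ℝ) 1
  measurable_H : ∀ n ≤ P.N, Measurable[P.filt n] (P.H n)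
  memLp_H : ∀ n ≤ P.N, MemLp (P.H n) 2 μ

/-- `∑_{i=n}^N w_i ∏_{j=n+1}^i (1 - β_jᵀ ΔS_j)²`. -/
noncomputable def sumA (n : ℕ) (x : Ω) : ℝ :=
  ∑ i ∈ Icc n P.N, P.w i x * P.tailProd (P.beta μ) (n + 1) i x ^ 2

/-- `∑_{i=n}^N w_i ∏_{j=n+1}^i (1 - β_jᵀ ΔS_j)`. -/
noncomputable def sumB (n : ℕ) (x : Ω) : ℝ :=
  ∑ i ∈ Icc n P.N, P.w i x * P.tailProd (P.beta μ) (n + 1) i x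

/-- `∑_{i=n}^N H_i w_i ∏_{j=n+1}^i (1 - β_jᵀ ΔS_j)`. -/
noncomputable def sumC (n : ℕ) (x : Ω) : ℝ :=
  ∑ i ∈ Icc n P.N, P.H i x * P.w i x * P.tailProd (P.beta μ) (n + 1) i x

/-- `∑_{i=n}^N w_i R_i ∏_{j=n+1}^i (1 - β_jᵀ ΔS_j)`, where `R_i` is the residual claim after
following the optimal strategy from time `n` on with zero wealth. -/
noncomputable def sumD (n : ℕ) (x : Ω) : ℝ :=
  ∑ i ∈ Icc n P.N, P.w i x * (P.H i x - P.rhoSum μ (n + 1) i x) *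
    P.tailProd (P.beta μ) (n + 1) i x

/-- `∑_{i=n}^N w_i R_i²`, with `R_i` as in `sumD`. -/
noncomputable def sumQ (n : ℕ) (x : Ω) : ℝ :=
  ∑ i ∈ Icc n P.N, P.w i x * (P.H i x - P.rhoSum μ (n + 1) i x) ^ 2

section Recursion

variable {P μ}

theorem tailProd_of_lt {b : ℕ → Ω → Fin M → ℝ} {n i : ℕ} (h : i < n) (x : Ω) :
    P.tailProd b n i x = 1 := by
  rw [tailProd, Finset.Icc_eq_empty (by omega), Finset.prod_empty]

theorem tailProd_left {b : ℕ → Ω → Fin M → ℝ} {n i : ℕ} (h : n ≤ i) (x : Ω) :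
    P.tailProd b n i x = (1 - b n x ⬝ᵥ P.dS n x) * P.tailProd b (n + 1) i x := by
  rw [tailProd, ← Finset.insert_Icc_add_one_left_eq_Icc h, Finset.prod_insert (by simp)]
  rfl

theorem tailProd_right {b : ℕ → Ω → Fin M → ℝ} {n i : ℕ} (h : n ≤ i + 1) (x : Ω) :
    P.tailProd b n (i + 1) x =
      P.tailProd b n i x * (1 - b (i + 1) x ⬝ᵥ P.dS (i + 1) x) :=
  Finset.prod_Icc_succ_top h _

theorem rhoSum_of_lt {n i : ℕ} (h : i < n) (x : Ω) : P.rhoSum μ n i x = 0 := by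
  rw [rhoSum, Finset.Icc_eq_empty (by omega), Finset.sum_empty]

theorem rhoSum_left {n i : ℕ} (h : n ≤ i) (x : Ω) :
    P.rhoSum μ n i x = (P.rho μ n x ⬝ᵥ P.dS n x) * P.tailProd (P.beta μ) (n + 1) i x +
      P.rhoSum μ (n + 1) i x := by
  rw [rhoSum, ← Finset.insert_Icc_add_one_left_eq_Icc h, Finset.sum_insert (by simp)]
  rfl

theorem rhoSum_right {n i : ℕ} (h : n ≤ i + 1) (x : Ω) :
    P.rhoSum μ n (i + 1) x = P.rhoSum μ n i x * (1 - P.beta μ (i + 1) x ⬝ᵥ P.dS (i + 1) x) +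
      P.rho μ (i + 1) x ⬝ᵥ P.dS (i + 1) x := by
  rw [rhoSum, Finset.sum_Icc_succ_top h, tailProd_of_lt (by omega : i + 1 < i + 1 + 1), mul_one,
    rhoSum, Finset.sum_mul]
  congr 1
  refine Finset.sum_congr rfl fun k hk => ?_
  rw [tailProd_right (by have := (Finset.mem_Icc.1 hk).2; omega), mul_assoc]

theorem sum_Icc_left {n N : ℕ} (h : n ≤ N) (f : ℕ → ℝ) :
    ∑ i ∈ Icc n N, f i = f n + ∑ i ∈ Icc (n + 1) N, f i := by
  rw [← Finset.insert_Icc_add_one_left_eq_Icc h, Finset.sum_insert (by simp)]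

theorem sumA_eq {n : ℕ} (h : n ≤ P.N) (x : Ω) :
    P.sumA μ n x = P.w n x + (1 - P.beta μ (n + 1) x ⬝ᵥ P.dS (n + 1) x) ^ 2 *
      P.sumA μ (n + 1) x := by
  rw [sumA, sum_Icc_left h, tailProd_of_lt (Nat.lt_succ_self n), sumA, Finset.mul_sum]
  congr 1
  · ring
  refine Finset.sum_congr rfl fun i hi => ?_
  rw [tailProd_left (Finset.mem_Icc.1 hi).1]
  ring

theorem sumB_eq {n : ℕ} (h : n ≤ P.N) (x : Ω) :
    P.sumB μ n x = P.w n x + (1 - P.beta μ (n + 1) x ⬝ᵥ P.dS (n + 1) x) *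
      P.sumB μ (n + 1) x := by
  rw [sumB, sum_Icc_left h, tailProd_of_lt (Nat.lt_succ_self n), sumB, Finset.mul_sum]
  congr 1
  · ring
  refine Finset.sum_congr rfl fun i hi => ?_
  rw [tailProd_left (Finset.mem_Icc.1 hi).1]
  ring

theorem sumC_eq {n : ℕ} (h : n ≤ P.N) (x : Ω) :
    P.sumC μ n x = P.H n x * P.w n x + (1 - P.beta μ (n + 1) x ⬝ᵥ P.dS (n + 1) x) *
      P.sumC μ (n + 1) x := by
  rw [sumC, sum_Icc_left h, tailProd_of_lt (Nat.lt_succ_self n), sumC, Finset.mul_sum]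
  congr 1
  · ring
  refine Finset.sum_congr rfl fun i hi => ?_
  rw [tailProd_left (Finset.mem_Icc.1 hi).1]
  ring

/-- Including date n + 1 subtracts ρᵀΔS · T_i from each residual and multiplies T_i by 1 - βᵀΔS,
which is how `sumA` enters. At n = N the sums on the right are empty. -/
theorem sumD_eq {n : ℕ} (h : n ≤ P.N) (x : Ω) :
    P.sumD μ n x = P.H n x * P.w n x + (1 - P.beta μ (n + 1) x ⬝ᵥ P.dS (n + 1) x) *
      (P.sumD μ (n + 1) x - (P.rho μ (n + 1) x ⬝ᵥ P.dS (n + 1) x) * P.sumA μ (n + 1) x) := by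
  rw [sumD, sum_Icc_left h, tailProd_of_lt (Nat.lt_succ_self n),
    rhoSum_of_lt (Nat.lt_succ_self n), sumD, sumA, Finset.mul_sum, ← Finset.sum_sub_distrib,
    Finset.mul_sum]
  congr 1
  · ring
  refine Finset.sum_congr rfl fun i hi => ?_
  rw [tailProd_left (Finset.mem_Icc.1 hi).1, rhoSum_left (Finset.mem_Icc.1 hi).1]
  ring

/-- The tail of the hedging error is a quadratic function of the wealth. -/
theorem quadratic_eq (n : ℕ) (y : ℝ) (x : Ω) :
    y ^ 2 * P.sumA μ n x - 2 * y * P.sumD μ n x + P.sumQ μ n x =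
      ∑ i ∈ Icc n P.N, P.w i x * (P.H i x - P.rhoSum μ (n + 1) i x -
        y * P.tailProd (P.beta μ) (n + 1) i x) ^ 2 := by
  rw [sumA, sumD, sumQ, Finset.mul_sum, Finset.mul_sum, ← Finset.sum_sub_distrib,
    ← Finset.sum_add_distrib]
  exact Finset.sum_congr rfl fun i _ => by ring

/-- The pathwise Bellman identity: one step of the recursive strategy moves the wealth from y to y +
(ρ - yβ)ᵀΔS. -/
theorem quadratic_left {n : ℕ} (h : n ≤ P.N) (y : ℝ) (x : Ω) :
    y ^ 2 * P.sumA μ n x - 2 * y * P.sumD μ n x + P.sumQ μ n x =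
      P.w n x * (P.H n x - y) ^ 2 +
      ((y + (P.rho μ (n + 1) x - y • P.beta μ (n + 1) x) ⬝ᵥ P.dS (n + 1) x) ^ 2 *
        P.sumA μ (n + 1) x -
      2 * (y + (P.rho μ (n + 1) x - y • P.beta μ (n + 1) x) ⬝ᵥ P.dS (n + 1) x) *
        P.sumD μ (n + 1) x + P.sumQ μ (n + 1) x) := by
  rw [quadratic_eq, quadratic_eq, sum_Icc_left h, tailProd_of_lt (Nat.lt_succ_self n),
    rhoSum_of_lt (Nat.lt_succ_self n)]
  congr 1
  · ring
  refine Finset.sum_congr rfl fun i hi => ?_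
  rw [tailProd_left (Finset.mem_Icc.1 hi).1, rhoSum_left (Finset.mem_Icc.1 hi).1,
    sub_dotProduct, smul_dotProduct, smul_eq_mul]
  ring

theorem sumQ_eq {n : ℕ} (h : n ≤ P.N) (x : Ω) :
    P.sumQ μ n x = P.w n x * P.H n x ^ 2 +
      ((P.rho μ (n + 1) x ⬝ᵥ P.dS (n + 1) x) ^ 2 * P.sumA μ (n + 1) x -
      2 * (P.rho μ (n + 1) x ⬝ᵥ P.dS (n + 1) x) * P.sumD μ (n + 1) x + P.sumQ μ (n + 1) x) := by
  have := quadratic_left (μ := μ) h 0 x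
  simpa using this

end Recursion

section Measurability

variable {P μ}

theorem measurable_delta (n : ℕ) (i j : Fin M) :
    Measurable[P.filt (n - 1)] fun x => P.delta μ n x i j :=
  measurable_genCondExp _

theorem measurable_beta (n : ℕ) : Measurable[P.filt (n - 1)] (P.beta μ n) := by
  by_cases h : 1 ≤ n ∧ n ≤ P.N
  · have : P.beta μ n = fun x => symPinv (P.delta μ n x) *ᵥ P.alpha μ n x :=
      funext fun x => P.beta_eq μ h.1 h.2 x
    rw [this]
    refine @measurable_mulVec _ _ (P.filt (n - 1)) _ _ (fun i j => ?_)
      (@measurable_pi_lambda _ _ _ (P.filt (n - 1)) _ _ fun a => measurable_genCondExp _)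
    exact @measurable_symPinv _ _ (P.filt (n - 1)) _ (fun i j => measurable_delta n i j)
      (fun x => P.deltaOf_isSymm μ _ n x) i j
  · rw [beta, dif_neg h]
    exact measurable_const

theorem measurable_rho (n : ℕ) : Measurable[P.filt (n - 1)] (P.rho μ n) := by
  rw [rho]
  split_ifs with h
  · refine @measurable_mulVec _ _ (P.filt (n - 1)) _ _ (fun i j => ?_)
      (@measurable_pi_lambda _ _ _ (P.filt (n - 1)) _ _ fun a => measurable_genCondExp _)
    exact @measurable_symPinv _ _ (P.filt (n - 1)) _ (fun i j => measurable_delta n i j)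
      (fun x => P.deltaOf_isSymm μ _ n x) i j
  · exact measurable_const

variable (hP : P.IsRegular μ)

include hP

theorem IsRegular.measurable_dS {n : ℕ} (hn : n ≤ P.N) : Measurable[P.filt n] (P.dS n) := by
  cases n with
  | zero => exact measurable_const
  | succ n =>
    exact (hP.measurable_S _ hn).sub
      ((hP.measurable_S n (by omega)).mono (P.filt.mono (Nat.le_succ n)) le_rfl)

theorem IsRegular.measurable_tailProd {k i : ℕ} (hi : i ≤ P.N) :
    Measurable (P.tailProd (P.beta μ) k i) := by
  refine Finset.measurable_prod _ fun j hj => ?_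
  have hj' := (Finset.mem_Icc.1 hj).2
  exact (measurable_dotProduct ((measurable_beta j).mono (P.filt.le _) le_rfl)
    ((hP.measurable_dS (hj'.trans hi)).mono (P.filt.le _) le_rfl)).const_sub 1

theorem IsRegular.measurable_rhoSum {k i : ℕ} (hi : i ≤ P.N) :
    Measurable (P.rhoSum μ k i) := by
  refine Finset.measurable_sum _ fun j hj => ?_
  have hj' := (Finset.mem_Icc.1 hj).2
  exact (measurable_dotProduct ((measurable_rho j).mono (P.filt.le _) le_rfl)
    ((hP.measurable_dS (hj'.trans hi)).mono (P.filt.le _) le_rfl)).mul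
    (hP.measurable_tailProd hi)

theorem IsRegular.measurable_w' {n : ℕ} (hn : n ≤ P.N) : Measurable (P.w n) :=
  (hP.measurable_w n hn).mono (P.filt.le _) le_rfl

theorem IsRegular.measurable_H' {n : ℕ} (hn : n ≤ P.N) : Measurable (P.H n) :=
  (hP.measurable_H n hn).mono (P.filt.le _) le_rfl

theorem IsRegular.measurable_sumA (n : ℕ) : Measurable (P.sumA μ n) :=
  Finset.measurable_sum _ fun i hi => by
    have hi' := (Finset.mem_Icc.1 hi).2
    exact (hP.measurable_w' hi').mul ((hP.measurable_tailProd hi').pow_const 2)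

theorem IsRegular.measurable_sumB (n : ℕ) : Measurable (P.sumB μ n) :=
  Finset.measurable_sum _ fun i hi => by
    have hi' := (Finset.mem_Icc.1 hi).2
    exact (hP.measurable_w' hi').mul (hP.measurable_tailProd hi')

theorem IsRegular.measurable_sumC (n : ℕ) : Measurable (P.sumC μ n) :=
  Finset.measurable_sum _ fun i hi => by
    have hi' := (Finset.mem_Icc.1 hi).2
    exact ((hP.measurable_H' hi').mul (hP.measurable_w' hi')).mul (hP.measurable_tailProd hi')

theorem IsRegular.measurable_sumD (n : ℕ) : Measurable (P.sumD μ n) :=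
  Finset.measurable_sum _ fun i hi => by
    have hi' := (Finset.mem_Icc.1 hi).2
    exact ((hP.measurable_w' hi').mul ((hP.measurable_H' hi').sub
      (hP.measurable_rhoSum hi'))).mul (hP.measurable_tailProd hi')

theorem IsRegular.measurable_sumQ (n : ℕ) : Measurable (P.sumQ μ n) :=
  Finset.measurable_sum _ fun i hi => by
    have hi' := (Finset.mem_Icc.1 hi).2
    exact (hP.measurable_w' hi').mul (((hP.measurable_H' hi').sub
      (hP.measurable_rhoSum hi')).pow_const 2)

theorem IsRegular.ae_w_mem : ∀ᵐ x ∂μ, ∀ i ≤ P.N, P.w i x ∈ Set.Icc (0 : ℝ) 1 :=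
  ae_all_iff.2 fun i => by
    by_cases hi : i ≤ P.N
    · filter_upwards [hP.w_mem i hi] with x hx _ using hx
    · exact ae_of_all _ fun x h => absurd h hi

end Measurability

end HedgingProblem

/-! ### Almost sure bounds and the backward invariant. -/

namespace HedgingProblem

variable {Ω : Type*} [mΩ : MeasurableSpace Ω] {M : ℕ} {P : HedgingProblem Ω M} {μ : Measure Ω}

section Pointwise

variable (hP : P.IsRegular μ)

include hP

theorem IsRegular.ae_sumA_nonneg (n : ℕ) : ∀ᵐ x ∂μ, 0 ≤ P.sumA μ n x := by
  filter_upwards [hP.ae_w_mem] with x hx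
  exact Finset.sum_nonneg fun i hi =>
    mul_nonneg (hx i (Finset.mem_Icc.1 hi).2).1 (sq_nonneg _)

theorem IsRegular.ae_sumQ_nonneg (n : ℕ) : ∀ᵐ x ∂μ, 0 ≤ P.sumQ μ n x := by
  filter_upwards [hP.ae_w_mem] with x hx
  exact Finset.sum_nonneg fun i hi =>
    mul_nonneg (hx i (Finset.mem_Icc.1 hi).2).1 (sq_nonneg _)

theorem IsRegular.ae_quadratic_nonneg (n : ℕ) :
    ∀ᵐ x ∂μ, ∀ y : ℝ, 0 ≤ y ^ 2 * P.sumA μ n x - 2 * y * P.sumD μ n x + P.sumQ μ n x := by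
  filter_upwards [hP.ae_w_mem] with x hx y
  rw [quadratic_eq]
  exact Finset.sum_nonneg fun i hi =>
    mul_nonneg (hx i (Finset.mem_Icc.1 hi).2).1 (sq_nonneg _)

/-- Vanishing of a sum of nonnegative terms w_i T_i² forces every w_i T_i to vanish. This is the
compatibility condition that makes the normal equations solvable. -/
theorem IsRegular.ae_eq_zero_of_sumA_eq_zero (n : ℕ) :
    ∀ᵐ x ∂μ, P.sumA μ n x = 0 → P.sumB μ n x = 0 ∧ P.sumC μ n x = 0 := by
  filter_upwards [hP.ae_w_mem] with x hx h0
  have h1 := (Finset.sum_eq_zero_iff_of_nonneg fun i hi =>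
    mul_nonneg (hx i (Finset.mem_Icc.1 hi).2).1 (sq_nonneg _)).1 h0
  have h2 : ∀ i ∈ Icc n P.N, P.w i x * P.tailProd (P.beta μ) (n + 1) i x = 0 := fun i hi => by
    rcases mul_eq_zero.1 (h1 i hi) with h | h
    · rw [h, zero_mul]
    · rw [pow_eq_zero_iff two_ne_zero] at h
      rw [h, mul_zero]
  refine ⟨Finset.sum_eq_zero h2, Finset.sum_eq_zero fun i hi => ?_⟩
  rw [mul_assoc, h2 i hi, mul_zero]

/-- This bound and its three analogues are applied with r a coordinate of ΔS, for conditional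
integrability; those for B, C and D also with r = 1, for integrability. -/
theorem IsRegular.ae_abs_mul_sumA_le (n : ℕ) (r : Ω → ℝ) :
    ∀ᵐ x ∂μ, |r x * P.sumA μ n x| ≤ r x ^ 2 * P.sumA μ n x + P.sumA μ n x := by
  filter_upwards [hP.ae_w_mem] with x hx
  have := abs_mul_sum_le (Icc n P.N) (w := fun i => P.w i x)
    (fun i hi => (hx i (Finset.mem_Icc.1 hi).2).1)
    (fun i => P.tailProd (P.beta μ) (n + 1) i x) (fun i => P.tailProd (P.beta μ) (n + 1) i x) (r x)
  simpa only [sumA, mul_assoc, ← pow_two] using this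

theorem IsRegular.ae_abs_mul_sumB_le (n : ℕ) (r : Ω → ℝ) :
    ∀ᵐ x ∂μ, |r x * P.sumB μ n x| ≤ r x ^ 2 * P.sumA μ n x + ∑ i ∈ Icc n P.N, P.w i x := by
  filter_upwards [hP.ae_w_mem] with x hx
  have := abs_mul_sum_le (Icc n P.N) (w := fun i => P.w i x)
    (fun i hi => (hx i (Finset.mem_Icc.1 hi).2).1)
    (fun i => 1) (fun i => P.tailProd (P.beta μ) (n + 1) i x) (r x)
  simpa only [sumA, sumB, one_pow, mul_one] using this

theorem IsRegular.ae_abs_mul_sumC_le (n : ℕ) (r : Ω → ℝ) :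
    ∀ᵐ x ∂μ, |r x * P.sumC μ n x| ≤
      r x ^ 2 * P.sumA μ n x + ∑ i ∈ Icc n P.N, P.w i x * P.H i x ^ 2 := by
  filter_upwards [hP.ae_w_mem] with x hx
  have := abs_mul_sum_le (Icc n P.N) (w := fun i => P.w i x)
    (fun i hi => (hx i (Finset.mem_Icc.1 hi).2).1)
    (fun i => P.H i x) (fun i => P.tailProd (P.beta μ) (n + 1) i x) (r x)
  simpa only [sumA, sumC, mul_comm (P.H _ x)] using this

theorem IsRegular.ae_abs_mul_sumD_le (n : ℕ) (r : Ω → ℝ) :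
    ∀ᵐ x ∂μ, |r x * P.sumD μ n x| ≤ r x ^ 2 * P.sumA μ n x + P.sumQ μ n x := by
  filter_upwards [hP.ae_w_mem] with x hx
  exact abs_mul_sum_le (Icc n P.N) (w := fun i => P.w i x)
    (fun i hi => (hx i (Finset.mem_Icc.1 hi).2).1)
    (fun i => P.H i x - P.rhoSum μ (n + 1) i x)
    (fun i => P.tailProd (P.beta μ) (n + 1) i x) (r x)

theorem IsRegular.integrable_w_mul_sq {i : ℕ} (hi : i ≤ P.N) :
    Integrable (fun x => P.w i x * P.H i x ^ 2) μ := by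
  refine (hP.memLp_H i hi).integrable_sq.mono'
    ((hP.measurable_w' hi).mul ((hP.measurable_H' hi).pow_const 2)).aestronglyMeasurable ?_
  filter_upwards [hP.w_mem i hi] with x hx
  rw [Real.norm_eq_abs, abs_of_nonneg (mul_nonneg hx.1 (sq_nonneg _))]
  nlinarith [hx.2, sq_nonneg (P.H i x)]

theorem IsRegular.integrable_sum_w_mul_sq (n : ℕ) :
    Integrable (fun x => ∑ i ∈ Icc n P.N, P.w i x * P.H i x ^ 2) μ :=
  integrable_finsetSum _ fun _ hi => hP.integrable_w_mul_sq (Finset.mem_Icc.1 hi).2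

variable [IsProbabilityMeasure μ]

theorem IsRegular.integrable_w {i : ℕ} (hi : i ≤ P.N) : Integrable (P.w i) μ := by
  refine Integrable.of_bound (hP.measurable_w' hi).aestronglyMeasurable 1 ?_
  filter_upwards [hP.w_mem i hi] with x hx
  rw [Real.norm_eq_abs, abs_of_nonneg hx.1]
  exact hx.2

theorem IsRegular.integrable_sum_w (n : ℕ) :
    Integrable (fun x => ∑ i ∈ Icc n P.N, P.w i x) μ :=
  integrable_finsetSum _ fun _ hi => hP.integrable_w (Finset.mem_Icc.1 hi).2

end Pointwise

variable (P μ) in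
/-- The invariant of the backward induction. -/
structure Invariant (n : ℕ) : Prop where
  bound : ∃ K : ℝ≥0∞, K ≠ ∞ ∧
    ∀ᵐ x ∂μ, condLExp (P.filt n) μ (fun x => ENNReal.ofReal (P.sumA μ n x)) x ≤ K
  lintegral_sumQ : ∫⁻ x, ENNReal.ofReal (P.sumQ μ n x) ∂μ ≠ ∞
  eqAB : genCondExp μ (P.filt n) (P.sumA μ n) =ᵐ[μ] genCondExp μ (P.filt n) (P.sumB μ n)
  eqCD : genCondExp μ (P.filt n) (P.sumC μ n) =ᵐ[μ] genCondExp μ (P.filt n) (P.sumD μ n)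

theorem integrable_of_lintegral_ofReal_ne_top {f : Ω → ℝ} (hf : Measurable f)
    (h0 : ∀ᵐ x ∂μ, 0 ≤ f x) (h : ∫⁻ x, ENNReal.ofReal (f x) ∂μ ≠ ∞) : Integrable f μ :=
  ⟨hf.aestronglyMeasurable, (hasFiniteIntegral_iff_ofReal h0).2 h.lt_top⟩

section Step

variable {n : ℕ} (hP : P.IsRegular μ) (hI : P.Invariant μ n)

include hP hI

theorem Invariant.integrable_sumQ : Integrable (P.sumQ μ n) μ :=
  integrable_of_lintegral_ofReal_ne_top (hP.measurable_sumQ n) (hP.ae_sumQ_nonneg n)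
    hI.lintegral_sumQ

variable [IsProbabilityMeasure μ]

theorem Invariant.integrable_sumA : Integrable (P.sumA μ n) μ := by
  obtain ⟨K, hK, h⟩ := hI.bound
  refine integrable_of_lintegral_ofReal_ne_top (hP.measurable_sumA n) (hP.ae_sumA_nonneg n) ?_
  rw [← lintegral_condLExp (P.filt.le n)]
  refine ((lintegral_mono_ae h).trans_lt ?_).ne
  simpa using hK.lt_top

theorem Invariant.integrable_sumB : Integrable (P.sumB μ n) μ := by
  refine ((hI.integrable_sumA hP).add (hP.integrable_sum_w n)).mono'
    (hP.measurable_sumB n).aestronglyMeasurable ?_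
  filter_upwards [hP.ae_abs_mul_sumB_le n fun _ => 1] with x hx
  simpa using hx

theorem Invariant.integrable_sumC : Integrable (P.sumC μ n) μ := by
  refine ((hI.integrable_sumA hP).add (hP.integrable_sum_w_mul_sq n)).mono'
    (hP.measurable_sumC n).aestronglyMeasurable ?_
  filter_upwards [hP.ae_abs_mul_sumC_le n fun _ => 1] with x hx
  simpa using hx

theorem Invariant.integrable_sumD : Integrable (P.sumD μ n) μ := by
  refine ((hI.integrable_sumA hP).add (hI.integrable_sumQ hP)).mono'
    (hP.measurable_sumD n).aestronglyMeasurable ?_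
  filter_upwards [hP.ae_abs_mul_sumD_le n fun _ => 1] with x hx
  simpa using hx

end Step

/-! ### The normal equations at one date. -/

section BackwardStep

variable {n : ℕ} (hP : P.IsRegular μ) (hn : n + 1 ≤ P.N) (hI : P.Invariant μ (n + 1))

include hP hn

theorem IsRegular.measurable_dS_apply (a : Fin M) :
    Measurable[P.filt (n + 1)] fun x => P.dS (n + 1) x a :=
  (measurable_pi_apply a).comp (hP.measurable_dS hn)

theorem IsRegular.measurable_dS_apply' (a : Fin M) : Measurable fun x => P.dS (n + 1) x a :=
  (hP.measurable_dS_apply hn a).mono (P.filt.le _) le_rfl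

variable [IsProbabilityMeasure μ]

include hI

/-- Here the deterministic bound in the invariant is needed: mere integrability of `sumA` would not
control its product with the square of ΔS. -/
theorem Invariant.condInt_sq (a : Fin M) :
    IsCondInt (P.filt n) μ fun x => P.dS (n + 1) x a ^ 2 * P.sumA μ (n + 1) x := by
  obtain ⟨K, hK, h⟩ := hI.bound
  exact IsCondInt.mul_of_condLExp_le (P.filt.mono (Nat.le_succ n)) (P.filt.le _)
    ((hP.measurable_dS_apply hn a).pow_const 2) (fun x => sq_nonneg _)
    (hP.condIntegrable_dS (n + 1) (by omega) hn a) (hP.measurable_sumA _)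
    (hP.ae_sumA_nonneg _) hK h

theorem Invariant.condInt_mul_mul (a b : Fin M) : IsCondInt (P.filt n) μ
    fun x => P.dS (n + 1) x a * P.dS (n + 1) x b * P.sumA μ (n + 1) x := by
  refine ((hI.condInt_sq hP hn a).add (hI.condInt_sq hP hn b)).mono
    (((hP.measurable_dS_apply' hn a).mul (hP.measurable_dS_apply' hn b)).mul
      (hP.measurable_sumA _)) ?_
  filter_upwards [hP.ae_sumA_nonneg (n + 1)] with x hx
  rw [abs_mul, abs_of_nonneg hx, ← add_mul]
  refine mul_le_mul_of_nonneg_right ?_ hx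
  rw [abs_le]
  constructor <;> nlinarith [sq_nonneg (P.dS (n + 1) x a + P.dS (n + 1) x b),
    sq_nonneg (P.dS (n + 1) x a - P.dS (n + 1) x b)]

theorem Invariant.condInt_mul_sumA (a : Fin M) :
    IsCondInt (P.filt n) μ fun x => P.dS (n + 1) x a * P.sumA μ (n + 1) x :=
  ((hI.condInt_sq hP hn a).add
    (.of_integrable (hP.measurable_sumA _) (hI.integrable_sumA hP))).mono
    ((hP.measurable_dS_apply' hn a).mul (hP.measurable_sumA _))
    (hP.ae_abs_mul_sumA_le (n + 1) fun x => P.dS (n + 1) x a)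

theorem Invariant.condInt_mul_sumB (a : Fin M) :
    IsCondInt (P.filt n) μ fun x => P.dS (n + 1) x a * P.sumB μ (n + 1) x :=
  ((hI.condInt_sq hP hn a).add (.of_integrable
    (Finset.measurable_sum _ fun _ hi => hP.measurable_w' (Finset.mem_Icc.1 hi).2)
    (hP.integrable_sum_w (n + 1)))).mono
    ((hP.measurable_dS_apply' hn a).mul (hP.measurable_sumB _))
    (hP.ae_abs_mul_sumB_le (n + 1) fun x => P.dS (n + 1) x a)

theorem Invariant.condInt_mul_sumC (a : Fin M) :
    IsCondInt (P.filt n) μ fun x => P.dS (n + 1) x a * P.sumC μ (n + 1) x :=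
  ((hI.condInt_sq hP hn a).add (.of_integrable
    (Finset.measurable_sum _ fun _ hi => (hP.measurable_w' (Finset.mem_Icc.1 hi).2).mul
      ((hP.measurable_H' (Finset.mem_Icc.1 hi).2).pow_const 2))
    (hP.integrable_sum_w_mul_sq (n + 1)))).mono
    ((hP.measurable_dS_apply' hn a).mul (hP.measurable_sumC _))
    (hP.ae_abs_mul_sumC_le (n + 1) fun x => P.dS (n + 1) x a)

theorem Invariant.condInt_mul_sumD (a : Fin M) :
    IsCondInt (P.filt n) μ fun x => P.dS (n + 1) x a * P.sumD μ (n + 1) x :=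
  ((hI.condInt_sq hP hn a).add
    (.of_integrable (hP.measurable_sumQ _) (hI.integrable_sumQ hP))).mono
    ((hP.measurable_dS_apply' hn a).mul (hP.measurable_sumD _))
    (hP.ae_abs_mul_sumD_le (n + 1) fun x => P.dS (n + 1) x a)

theorem Invariant.delta_mulVec_beta :
    ∀ᵐ x ∂μ, P.delta μ (n + 1) x *ᵥ P.beta μ (n + 1) x = P.alpha μ (n + 1) x := by
  filter_upwards [condMoment_mulVec_symPinv (P.filt.le n) (hI.condInt_mul_mul hP hn)
    (hP.ae_sumA_nonneg _) (hI.condInt_mul_sumB hP hn) (by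
      filter_upwards [hP.ae_eq_zero_of_sumA_eq_zero (n + 1)] with x hx h using (hx h).1)]
    with x hx
  rw [P.beta_eq μ (by omega) hn]
  exact hx

theorem Invariant.delta_mulVec_rho :
    ∀ᵐ x ∂μ, P.delta μ (n + 1) x *ᵥ P.rho μ (n + 1) x = P.eta μ (n + 1) x := by
  filter_upwards [condMoment_mulVec_symPinv (P.filt.le n) (hI.condInt_mul_mul hP hn)
    (hP.ae_sumA_nonneg _) (hI.condInt_mul_sumC hP hn) (by
      filter_upwards [hP.ae_eq_zero_of_sumA_eq_zero (n + 1)] with x hx h using (hx h).2)]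
    with x hx
  rw [rho, if_pos ⟨by omega, hn⟩]
  exact hx

/-- Conditioning first on the information at n + 1 pulls ΔS_{n+1} out, and the invariant there
exchanges B for A. Thus β solves a genuine least squares problem with weight A. -/
theorem Invariant.alpha_eq : ∀ᵐ x ∂μ, P.alpha μ (n + 1) x =
    fun a => genCondExp μ (P.filt n) (fun y => P.dS (n + 1) y a * P.sumA μ (n + 1) y) x := by
  have : ∀ᵐ x ∂μ, ∀ a, P.alpha μ (n + 1) x a =
      genCondExp μ (P.filt n) (fun y => P.dS (n + 1) y a * P.sumA μ (n + 1) y) x :=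
    ae_all_iff.2 fun a => genCondExp_mul_congr (P.filt.mono (Nat.le_succ n)) (P.filt.le _)
      (hP.measurable_dS_apply hn a)
      (.of_integrable (hP.measurable_sumB _) (hI.integrable_sumB hP))
      (.of_integrable (hP.measurable_sumA _) (hI.integrable_sumA hP))
      (hI.condInt_mul_sumB hP hn a) (hI.condInt_mul_sumA hP hn a) hI.eqAB.symm
  filter_upwards [this] with x hx using funext hx

/-- The same exchange, now of C for D, lets η carry the residuals left by later hedging. -/
theorem Invariant.eta_eq : ∀ᵐ x ∂μ, P.eta μ (n + 1) x =
    fun a => genCondExp μ (P.filt n) (fun y => P.dS (n + 1) y a * P.sumD μ (n + 1) y) x := by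
  have : ∀ᵐ x ∂μ, ∀ a, P.eta μ (n + 1) x a =
      genCondExp μ (P.filt n) (fun y => P.dS (n + 1) y a * P.sumD μ (n + 1) y) x :=
    ae_all_iff.2 fun a => genCondExp_mul_congr (P.filt.mono (Nat.le_succ n)) (P.filt.le _)
      (hP.measurable_dS_apply hn a)
      (.of_integrable (hP.measurable_sumC _) (hI.integrable_sumC hP))
      (.of_integrable (hP.measurable_sumD _) (hI.integrable_sumD hP))
      (hI.condInt_mul_sumC hP hn a) (hI.condInt_mul_sumD hP hn a) hI.eqCD
  filter_upwards [this] with x hx using funext hx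

end BackwardStep

end HedgingProblem

/-! ### Backward propagation of the invariant. -/

namespace HedgingProblem

variable {Ω : Type*} [mΩ : MeasurableSpace Ω] {M : ℕ} {P : HedgingProblem Ω M} {μ : Measure Ω}
  [IsProbabilityMeasure μ]

theorem genCondExp_sub_eq_zero_of_succ {n : ℕ} {X Y : Ω → ℝ} (hX : Measurable X)
    (hY : Measurable Y)
    (hXi : Integrable X μ) (hYi : Integrable Y μ)
    (h : genCondExp μ (P.filt (n + 1)) X =ᵐ[μ] genCondExp μ (P.filt (n + 1)) Y) :
    ∀ᵐ x ∂μ, genCondExp μ (P.filt n) (fun x => X x - Y x) x = 0 := by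
  have t : ∀ Z : Ω → ℝ, Measurable Z → Integrable Z μ →
      genCondExp μ (P.filt n) (genCondExp μ (P.filt (n + 1)) Z) =ᵐ[μ]
      genCondExp μ (P.filt n) Z := fun Z hZ hZi =>
    genCondExp_genCondExp_of_le (P.filt.mono (Nat.le_succ n)) (P.filt.le _)
      (.of_integrable hZ hZi) (.of_integrable hZ hZi)
  filter_upwards [genCondExp_sub (m := P.filt n) (.of_integrable hX hXi) (.of_integrable hY hYi),
    t X hX hXi, t Y hY hYi, genCondExp_congr (m := P.filt n) h] with x h1 h2 h3 h4
  rw [h1, ← h2, ← h3, h4, sub_self]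

section BackwardStep

variable {n : ℕ} (hP : P.IsRegular μ) (hn : n + 1 ≤ P.N) (hI : P.Invariant μ (n + 1))

include hP hn hI

/-- With p = βᵀΔS and A, B at n + 1, the recursions give A_n - B_n = (A - B) + p(B - A) + (p²A -
pA). The first two terms have zero conditional expectation by the invariant, the last because βᵀδβ =
βᵀα. -/
theorem Invariant.eqAB_of_succ :
    genCondExp μ (P.filt n) (P.sumA μ n) =ᵐ[μ] genCondExp μ (P.filt n) (P.sumB μ n) := by
  have hm := P.filt.le n
  have hβ : Measurable[P.filt n] (P.beta μ (n + 1)) := measurable_beta (n + 1)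
  have iA := hI.condInt_mul_sumA hP hn
  have iB := hI.condInt_mul_sumB hP hn
  have iXX := hI.condInt_mul_mul hP hn
  have a1 : IsCondInt (P.filt n) μ (P.sumA μ (n + 1)) :=
    .of_integrable (hP.measurable_sumA _) (hI.integrable_sumA hP)
  have a2 : IsCondInt (P.filt n) μ (P.sumB μ (n + 1)) :=
    .of_integrable (hP.measurable_sumB _) (hI.integrable_sumB hP)
  have a3 := IsCondInt.dotProduct_mul hm hβ iA
  have a4 := IsCondInt.dotProduct_mul hm hβ iB
  have a5 := IsCondInt.dotProduct_mul_dotProduct_mul hm hβ hβ iXX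
  have a6 := a2.sub a4
  have w1 : IsCondInt (P.filt n) μ (P.w n) :=
    .of_integrable (hP.measurable_w' (by omega)) (hP.integrable_w (by omega))
  have e1 : P.sumA μ n = fun x => (P.w n x + (P.sumB μ (n + 1) x -
      (P.beta μ (n + 1) x ⬝ᵥ P.dS (n + 1) x) * P.sumB μ (n + 1) x)) +
      ((P.sumA μ (n + 1) x - P.sumB μ (n + 1) x) +
      (((P.beta μ (n + 1) x ⬝ᵥ P.dS (n + 1) x) * P.sumB μ (n + 1) x -
        (P.beta μ (n + 1) x ⬝ᵥ P.dS (n + 1) x) * P.sumA μ (n + 1) x) +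
      ((P.beta μ (n + 1) x ⬝ᵥ P.dS (n + 1) x) *
        ((P.beta μ (n + 1) x ⬝ᵥ P.dS (n + 1) x) * P.sumA μ (n + 1) x) -
        (P.beta μ (n + 1) x ⬝ᵥ P.dS (n + 1) x) * P.sumA μ (n + 1) x))) := by
    funext x
    rw [sumA_eq (by omega)]
    ring
  have e2 : P.sumB μ n = fun x => P.w n x + (P.sumB μ (n + 1) x -
      (P.beta μ (n + 1) x ⬝ᵥ P.dS (n + 1) x) * P.sumB μ (n + 1) x) := by
    funext x
    rw [sumB_eq (by omega)]
    ring
  rw [e1, e2]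
  filter_upwards [genCondExp_add (w1.add a6) ((a1.sub a2).add ((a4.sub a3).add (a5.sub a3))),
    genCondExp_add (a1.sub a2) ((a4.sub a3).add (a5.sub a3)),
    genCondExp_add (a4.sub a3) (a5.sub a3), genCondExp_sub a4 a3, genCondExp_sub a5 a3,
    genCondExp_sub_eq_zero_of_succ (hP.measurable_sumA _) (hP.measurable_sumB _)
      (hI.integrable_sumA hP) (hI.integrable_sumB hP) hI.eqAB,
    genCondExp_dotProduct_mul hm hβ iA, genCondExp_dotProduct_mul hm hβ iB,
    genCondExp_dotProduct_mul_dotProduct_mul hm hβ hβ iXX, hI.alpha_eq hP hn,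
    hI.delta_mulVec_beta hP hn] with x h1 h2 h3 h4 h5 h6 h7 h8 h9 h10 h11
  -- By definition δ_{n+1} is the conditional moment matrix of ΔS_{n+1} with weight `sumA`.
  have h12 : condMoment (P.filt n) μ (P.dS (n + 1)) (P.sumA μ (n + 1)) x *ᵥ P.beta μ (n + 1) x =
    P.alpha μ (n + 1) x := h11
  have h13 : (fun a => genCondExp μ (P.filt n)
    (fun y => P.dS (n + 1) y a * P.sumB μ (n + 1) y) x) = P.alpha μ (n + 1) x := rfl
  rw [h1, h2, h3, h4, h5, h6, h7, h8, h9, h12, h13, h10]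
  ring

/-- With r = ρᵀΔS, the terms of D_n - C_n are (D - C), p(C - D) and prA - rA. The first two vanish
conditionally by the invariant, the last because ρᵀδβ = ρᵀα. -/
theorem Invariant.eqCD_of_succ :
    genCondExp μ (P.filt n) (P.sumC μ n) =ᵐ[μ] genCondExp μ (P.filt n) (P.sumD μ n) := by
  have hm := P.filt.le n
  have hβ : Measurable[P.filt n] (P.beta μ (n + 1)) := measurable_beta (n + 1)
  have hρ : Measurable[P.filt n] (P.rho μ (n + 1)) := measurable_rho (n + 1)
  have iA := hI.condInt_mul_sumA hP hn
  have iC := hI.condInt_mul_sumC hP hn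
  have iD := hI.condInt_mul_sumD hP hn
  have iXX := hI.condInt_mul_mul hP hn
  have c1 : IsCondInt (P.filt n) μ (P.sumC μ (n + 1)) :=
    .of_integrable (hP.measurable_sumC _) (hI.integrable_sumC hP)
  have c2 : IsCondInt (P.filt n) μ (P.sumD μ (n + 1)) :=
    .of_integrable (hP.measurable_sumD _) (hI.integrable_sumD hP)
  have a3 := IsCondInt.dotProduct_mul hm hβ iC
  have a4 := IsCondInt.dotProduct_mul hm hβ iD
  have a5 := IsCondInt.dotProduct_mul_dotProduct_mul hm hρ hβ iXX
  have a6 := IsCondInt.dotProduct_mul hm hρ iA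
  have iHw : IsCondInt (P.filt n) μ fun x => P.H n x * P.w n x := by
    refine ((IsCondInt.of_integrable (m := P.filt n) (hP.measurable_w' (by omega))
      (hP.integrable_w (by omega))).mul_left hm (hP.measurable_H n (by omega)))
  have hC : IsCondInt (P.filt n) μ (P.sumC μ n) := by
    have := iHw.add (c1.sub a3)
    convert this using 1
    funext x
    rw [sumC_eq (by omega)]
    ring
  have e1 : P.sumD μ n = fun x => P.sumC μ n x +
      ((P.sumD μ (n + 1) x - P.sumC μ (n + 1) x) +
      (((P.beta μ (n + 1) x ⬝ᵥ P.dS (n + 1) x) * P.sumC μ (n + 1) x -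
        (P.beta μ (n + 1) x ⬝ᵥ P.dS (n + 1) x) * P.sumD μ (n + 1) x) +
      ((P.rho μ (n + 1) x ⬝ᵥ P.dS (n + 1) x) *
        ((P.beta μ (n + 1) x ⬝ᵥ P.dS (n + 1) x) * P.sumA μ (n + 1) x) -
        (P.rho μ (n + 1) x ⬝ᵥ P.dS (n + 1) x) * P.sumA μ (n + 1) x))) := by
    funext x
    rw [sumC_eq (by omega), sumD_eq (by omega)]
    ring
  rw [e1]
  filter_upwards [genCondExp_add hC ((c2.sub c1).add ((a3.sub a4).add (a5.sub a6))),
    genCondExp_add (c2.sub c1) ((a3.sub a4).add (a5.sub a6)),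
    genCondExp_add (a3.sub a4) (a5.sub a6), genCondExp_sub a3 a4, genCondExp_sub a5 a6,
    genCondExp_sub_eq_zero_of_succ (hP.measurable_sumD _) (hP.measurable_sumC _)
      (hI.integrable_sumD hP) (hI.integrable_sumC hP) hI.eqCD.symm,
    genCondExp_dotProduct_mul hm hβ iC, genCondExp_dotProduct_mul hm hβ iD,
    genCondExp_dotProduct_mul_dotProduct_mul hm hρ hβ iXX, genCondExp_dotProduct_mul hm hρ iA,
    hI.alpha_eq hP hn, hI.eta_eq hP hn, hI.delta_mulVec_beta hP hn]
    with x h1 h2 h3 h4 h5 h6 h7 h8 h9 h10 h11 h12 h13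
  have h14 : condMoment (P.filt n) μ (P.dS (n + 1)) (P.sumA μ (n + 1)) x *ᵥ P.beta μ (n + 1) x =
    P.alpha μ (n + 1) x := h13
  have h15 : (fun a => genCondExp μ (P.filt n)
    (fun y => P.dS (n + 1) y a * P.sumC μ (n + 1) y) x) = P.eta μ (n + 1) x := rfl
  rw [h1, h2, h3, h4, h5, h6, h7, h8, h9, h10, h14, h15, h11, h12]
  ring

/-- Since A_n = w_n + (1 - βᵀΔS)² A_{n+1} and β minimises the conditional expectation of the second
term, comparison with the zero vector bounds it by E[A_{n+1} | F_n] ≤ K. The weight w_n ≤ 1 adds at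
most 1. -/
theorem Invariant.bound_of_succ : ∃ K : ℝ≥0∞, K ≠ ∞ ∧
    ∀ᵐ x ∂μ, condLExp (P.filt n) μ (fun x => ENNReal.ofReal (P.sumA μ n x)) x ≤ K := by
  obtain ⟨K, hK, h⟩ := hI.bound
  have hm := P.filt.le n
  have hβ : Measurable[P.filt n] (P.beta μ (n + 1)) := measurable_beta (n + 1)
  have hA1 : IsCondInt (P.filt n) μ (P.sumA μ (n + 1)) :=
    .of_integrable (hP.measurable_sumA _) (hI.integrable_sumA hP)
  -- With D and q both equal to A the quadratic is (1 - y)² A, whose normal equations read δβ = α.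
  have h1 := condLExp_quadratic_le hm (φ := fun _ => 0) measurable_const hβ
    (hI.condInt_mul_mul hP hn) (hP.ae_sumA_nonneg _) (hI.condInt_mul_sumA hP hn) hA1
    (by
      filter_upwards [hP.ae_sumA_nonneg (n + 1)] with x hx y
      nlinarith [mul_nonneg (sq_nonneg (y - 1)) hx])
    (by
      filter_upwards [hI.alpha_eq hP hn, hI.delta_mulVec_beta hP hn] with x h1 h2
      exact h2.trans h1)
  simp only [zero_dotProduct, ne_eq, OfNat.ofNat_ne_zero, not_false_eq_true, zero_pow, zero_mul,
    mul_zero, sub_zero, zero_add] at h1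
  have h2 := condLExp_condLExp_of_le (P.filt.mono (Nat.le_succ n)) (P.filt.le _) (μ := μ)
    (fun x => ENNReal.ofReal (P.sumA μ (n + 1) x))
  have h3 := condLExp_mono (mΩ := P.filt n) (P := μ) (Y := fun _ => K) h
  rw [condLExp_const hm] at h3
  have h4 := condLExp_mono (mΩ := P.filt n) (P := μ) (X := fun x => ENNReal.ofReal (P.sumA μ n x))
    (Y := (fun _ => (1 : ℝ≥0∞)) + fun x => ENNReal.ofReal
      ((P.beta μ (n + 1) x ⬝ᵥ P.dS (n + 1) x) ^ 2 * P.sumA μ (n + 1) x -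
      2 * (P.beta μ (n + 1) x ⬝ᵥ P.dS (n + 1) x) * P.sumA μ (n + 1) x + P.sumA μ (n + 1) x)) (by
    filter_upwards [hP.w_mem n (by omega)] with x hx
    rw [sumA_eq (by omega)]
    refine ENNReal.ofReal_add_le.trans ?_
    refine add_le_add (ENNReal.ofReal_le_one.2 hx.2) (ENNReal.ofReal_le_ofReal (le_of_eq ?_))
    ring)
  have h5 := condLExp_add_left (mΩ := P.filt n) (P := μ) (X := fun _ => (1 : ℝ≥0∞))
    (fun x => ENNReal.ofReal
      ((P.beta μ (n + 1) x ⬝ᵥ P.dS (n + 1) x) ^ 2 * P.sumA μ (n + 1) x -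
      2 * (P.beta μ (n + 1) x ⬝ᵥ P.dS (n + 1) x) * P.sumA μ (n + 1) x + P.sumA μ (n + 1) x))
    aemeasurable_const
  rw [condLExp_const hm] at h5
  refine ⟨1 + K, by simp [hK], ?_⟩
  filter_upwards [h1, h2, h3, h4, h5] with x h1 h2 h3 h4 h5
  refine h4.trans (h5.trans_le ?_)
  exact add_le_add le_rfl (h1.trans (h2.symm.trans_le h3))

/-- Hedging optimally at time `n + 1` minimises the expected tail of the hedging error. -/
theorem Invariant.lintegral_quadratic_le {g : Ω → ℝ} (hg : Measurable[P.filt n] g)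
    {ξ : Ω → Fin M → ℝ} (hξ : Measurable[P.filt n] ξ) :
    ∫⁻ x, ENNReal.ofReal
      ((g x + (P.rho μ (n + 1) x - g x • P.beta μ (n + 1) x) ⬝ᵥ P.dS (n + 1) x) ^ 2 *
        P.sumA μ (n + 1) x -
      2 * (g x + (P.rho μ (n + 1) x - g x • P.beta μ (n + 1) x) ⬝ᵥ P.dS (n + 1) x) *
        P.sumD μ (n + 1) x + P.sumQ μ (n + 1) x) ∂μ ≤
    ∫⁻ x, ENNReal.ofReal ((g x + ξ x ⬝ᵥ P.dS (n + 1) x) ^ 2 * P.sumA μ (n + 1) x -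
      2 * (g x + ξ x ⬝ᵥ P.dS (n + 1) x) * P.sumD μ (n + 1) x + P.sumQ μ (n + 1) x) ∂μ := by
  have hm := P.filt.le n
  have hβ : Measurable[P.filt n] (P.beta μ (n + 1)) := measurable_beta (n + 1)
  have hρ : Measurable[P.filt n] (P.rho μ (n + 1)) := measurable_rho (n + 1)
  have hψ : Measurable[P.filt n] fun x => P.rho μ (n + 1) x - g x • P.beta μ (n + 1) x :=
    hρ.sub (hg.smul hβ)
  have iA := hI.condInt_mul_sumA hP hn
  have iD := hI.condInt_mul_sumD hP hn
  have b1 : IsCondInt (P.filt n) μ (P.sumA μ (n + 1)) :=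
    .of_integrable (hP.measurable_sumA _) (hI.integrable_sumA hP)
  have b2 : IsCondInt (P.filt n) μ (P.sumD μ (n + 1)) :=
    .of_integrable (hP.measurable_sumD _) (hI.integrable_sumD hP)
  have b3 : IsCondInt (P.filt n) μ (P.sumQ μ (n + 1)) :=
    .of_integrable (hP.measurable_sumQ _) (hI.integrable_sumQ hP)
  have i1 : ∀ a, IsCondInt (P.filt n) μ fun x =>
      g x * (P.dS (n + 1) x a * P.sumA μ (n + 1) x) := fun a => (iA a).mul_left hm hg
  have e1 : ∀ a, (fun x => P.dS (n + 1) x a *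
      (P.sumD μ (n + 1) x - g x * P.sumA μ (n + 1) x)) = fun x =>
      P.dS (n + 1) x a * P.sumD μ (n + 1) x - g x * (P.dS (n + 1) x a * P.sumA μ (n + 1) x) :=
    fun a => by funext x; ring
  have i2 : ∀ a, IsCondInt (P.filt n) μ fun x => P.dS (n + 1) x a *
      (P.sumD μ (n + 1) x - g x * P.sumA μ (n + 1) x) := fun a => by
    rw [e1]
    exact (iD a).sub (i1 a)
  have i3 : IsCondInt (P.filt n) μ fun x => g x ^ 2 * P.sumA μ (n + 1) x -
      2 * g x * P.sumD μ (n + 1) x + P.sumQ μ (n + 1) x :=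
    ((b1.mul_left hm (hg.pow_const 2)).sub (b2.mul_left hm (hg.const_mul 2))).add b3
  -- Expanding the quadratic at g + ξᵀΔS turns its linear coefficient into D - gA. Since g is known
  -- at time n, the right-hand side is η - gα, solved by ρ - gβ by linearity.
  have hn' : ∀ᵐ x ∂μ, condMoment (P.filt n) μ (P.dS (n + 1)) (P.sumA μ (n + 1)) x *ᵥ
      (P.rho μ (n + 1) x - g x • P.beta μ (n + 1) x) = fun a => genCondExp μ (P.filt n)
      (fun x => P.dS (n + 1) x a * (P.sumD μ (n + 1) x - g x * P.sumA μ (n + 1) x)) x := by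
    have k1 : ∀ᵐ x ∂μ, ∀ a, genCondExp μ (P.filt n)
        (fun x => P.dS (n + 1) x a * (P.sumD μ (n + 1) x - g x * P.sumA μ (n + 1) x)) x =
        genCondExp μ (P.filt n) (fun x => P.dS (n + 1) x a * P.sumD μ (n + 1) x) x -
        g x * genCondExp μ (P.filt n) (fun x => P.dS (n + 1) x a * P.sumA μ (n + 1) x) x := by
      refine ae_all_iff.2 fun a => ?_
      rw [e1]
      filter_upwards [genCondExp_sub (iD a) (i1 a), genCondExp_mul_left hm hg (iA a)] with x h1 h2
      rw [h1, h2]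
    filter_upwards [k1, hI.alpha_eq hP hn, hI.eta_eq hP hn, hI.delta_mulVec_beta hP hn,
      hI.delta_mulVec_rho hP hn] with x k1 k2 k3 k4 k5
    have k6 : condMoment (P.filt n) μ (P.dS (n + 1)) (P.sumA μ (n + 1)) x = P.delta μ (n + 1) x :=
      rfl
    rw [k6, Matrix.mulVec_sub, Matrix.mulVec_smul, k4, k5, k2, k3]
    funext a
    rw [k1 a]
    rfl
  have key := condLExp_quadratic_le hm hξ hψ (hI.condInt_mul_mul hP hn) (hP.ae_sumA_nonneg _)
    i2 i3 (by
      filter_upwards [hP.ae_quadratic_nonneg (n + 1)] with x hx y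
      have := hx (g x + y)
      nlinarith [this]) hn'
  have key2 := lintegral_mono_ae key
  rw [lintegral_condLExp hm, lintegral_condLExp hm] at key2
  refine (le_of_eq ?_).trans (key2.trans (le_of_eq ?_)) <;>
  · refine lintegral_congr fun x => ?_
    congr 1
    ring

/-- Here Q_n is the optimal tail error from zero wealth. Comparison with holding nothing at n + 1
bounds its expectation by E[w_n H_n²] + E[Q_{n+1}]. -/
theorem Invariant.lintegral_sumQ_of_succ : ∫⁻ x, ENNReal.ofReal (P.sumQ μ n x) ∂μ ≠ ∞ := by
  have h := hI.lintegral_quadratic_le hP hn (g := fun _ => 0) measurable_const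
    (ξ := fun _ => 0) measurable_const
  simp only [zero_dotProduct, zero_smul, sub_zero, add_zero, zero_add, ne_eq,
    OfNat.ofNat_ne_zero, not_false_eq_true, zero_pow, zero_mul, mul_zero] at h
  refine ne_top_of_le_ne_top (ENNReal.add_ne_top.2
    ⟨(hP.integrable_w_mul_sq (by omega : n ≤ P.N)).lintegral_lt_top.ne, hI.lintegral_sumQ⟩)
    (le_trans ?_ (add_le_add le_rfl h))
  rw [← lintegral_add_left (by
    have h1 := hP.measurable_w' (by omega : n ≤ P.N)
    have h2 := hP.measurable_H' (by omega : n ≤ P.N)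
    fun_prop)]
  refine lintegral_mono fun x => ?_
  rw [sumQ_eq (by omega)]
  exact ENNReal.ofReal_add_le

theorem Invariant.of_succ : P.Invariant μ n :=
  ⟨hI.bound_of_succ hP hn, hI.lintegral_sumQ_of_succ hP hn, hI.eqAB_of_succ hP hn,
    hI.eqCD_of_succ hP hn⟩

end BackwardStep

/-- At the horizon every product is 1 and every `rhoSum` is 0, so A and B coincide, as do C and D.
-/
theorem IsRegular.invariant_last (hP : P.IsRegular μ) : P.Invariant μ P.N := by
  have hA : P.sumA μ P.N = P.w P.N := by
    funext x; simp [sumA, tailProd_of_lt]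
  have hB : P.sumB μ P.N = P.w P.N := by
    funext x; simp [sumB, tailProd_of_lt]
  have hC : P.sumC μ P.N = fun x => P.H P.N x * P.w P.N x := by
    funext x; simp [sumC, tailProd_of_lt]
  have hD : P.sumD μ P.N = fun x => P.H P.N x * P.w P.N x := by
    funext x; simp [sumD, tailProd_of_lt, rhoSum_of_lt, mul_comm]
  have hQ : P.sumQ μ P.N = fun x => P.w P.N x * P.H P.N x ^ 2 := by
    funext x; simp [sumQ, rhoSum_of_lt]
  refine ⟨⟨1, ENNReal.one_ne_top, ?_⟩, ?_, by rw [hA, hB], by rw [hC, hD]⟩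
  · have := condLExp_mono (mΩ := P.filt P.N) (P := μ)
      (X := fun x => ENNReal.ofReal (P.sumA μ P.N x)) (Y := fun _ => 1) (by
        filter_upwards [hP.w_mem P.N le_rfl] with x hx
        rw [hA]
        exact ENNReal.ofReal_le_one.2 hx.2)
    rwa [condLExp_const (P.filt.le _)] at this
  · rw [hQ]
    exact (hP.integrable_w_mul_sq le_rfl).lintegral_lt_top.ne

theorem IsRegular.invariant (hP : P.IsRegular μ) {n : ℕ} (hn : n ≤ P.N) : P.Invariant μ n := by
  induction hn using Nat.decreasingInduction with
  | self => exact hP.invariant_last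
  | of_succ k hk ih => exact ih.of_succ hP hk

end HedgingProblem

/-! ### Wealth, optimality and the value function. -/

namespace HedgingProblem

variable {Ω : Type*} [mΩ : MeasurableSpace Ω] {M : ℕ} {P : HedgingProblem Ω M} {μ : Measure Ω}

theorem gain_succ (ξ : ℕ → Ω → Fin M → ℝ) (n : ℕ) (x : Ω) :
    P.gain ξ (n + 1) x = P.gain ξ n x + ξ (n + 1) x ⬝ᵥ P.dS (n + 1) x := by
  rw [gain, Finset.sum_Icc_succ_top (by omega), ← gain]

theorem gain_zero (ξ : ℕ → Ω → Fin M → ℝ) (x : Ω) : P.gain ξ 0 x = 0 := by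
  simp [gain]

theorem IsRegular.measurable_gain (hP : P.IsRegular μ) {ξ : ℕ → Ω → Fin M → ℝ}
    (hξ : P.Admissible ξ) {n : ℕ} (hn : n ≤ P.N) : Measurable[P.filt n] (P.gain ξ n) := by
  induction n with
  | zero =>
    have : P.gain ξ 0 = fun _ => 0 := funext (gain_zero ξ)
    rw [this]
    exact measurable_const
  | succ n ih =>
    have : P.gain ξ (n + 1) = fun x => P.gain ξ n x + ξ (n + 1) x ⬝ᵥ P.dS (n + 1) x :=
      funext (gain_succ ξ n)
    rw [this]
    have hle := P.filt.mono (Nat.le_succ n)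
    exact ((ih (by omega)).mono hle le_rfl).add (@measurable_dotProduct _ _ (P.filt (n + 1)) _ _
      ((hξ n hn).mono hle le_rfl) (hP.measurable_dS hn))

/-- Proved by its own induction: `measurable_gain` presupposes admissibility, which for the
recursive strategy depends on the present fact. -/
theorem IsRegular.measurable_optGain (hP : P.IsRegular μ) (c : ℝ) {n : ℕ} (hn : n ≤ P.N) :
    Measurable[P.filt n] (P.optGain μ c n) := by
  induction n with
  | zero => exact measurable_const
  | succ n ih =>
    have hle := P.filt.mono (Nat.le_succ n)
    have hg := (ih (by omega)).mono hle le_rfl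
    have hβ : Measurable[P.filt (n + 1)] (P.beta μ (n + 1)) :=
      (measurable_beta (n + 1)).mono hle le_rfl
    have hρ : Measurable[P.filt (n + 1)] (P.rho μ (n + 1)) :=
      (measurable_rho (n + 1)).mono hle le_rfl
    exact hg.add (@measurable_dotProduct _ _ (P.filt (n + 1)) _ _
      (hρ.sub ((hg.const_add c).smul hβ)) (hP.measurable_dS hn))

theorem IsRegular.admissible_optStrategy (hP : P.IsRegular μ) (c : ℝ) :
    P.Admissible (P.optStrategy μ c) := by
  intro n hn
  have hβ : Measurable[P.filt n] (P.beta μ (n + 1)) := measurable_beta (n + 1)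
  have hρ : Measurable[P.filt n] (P.rho μ (n + 1)) := measurable_rho (n + 1)
  exact hρ.sub (((hP.measurable_optGain c hn.le).const_add c).smul hβ)

/-- Wealth W = c + G obeys W_{j+1} = (1 - βᵀΔS) W_j + ρᵀΔS with coefficients at j + 1; this is
variation of constants from time k. -/
theorem wealth_eq_succ (c : ℝ) {k n : ℕ} (hk : k ≤ n) (x : Ω) :
    c + P.optGain μ c n x = P.rhoSum μ (k + 1) n x +
      (c + P.optGain μ c k x) * P.tailProd (P.beta μ) (k + 1) n x := by
  induction n, hk using Nat.le_induction with
  | base => rw [rhoSum_of_lt (Nat.lt_succ_self k), tailProd_of_lt (Nat.lt_succ_self k)]; ring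
  | succ n hk ih =>
    rw [rhoSum_right (by omega), tailProd_right (by omega), optGain]
    simp only [sub_dotProduct, smul_dotProduct, smul_eq_mul]
    rw [← add_assoc, ih]
    ring

/-- The wealth of the optimal strategy, in terms of its value at an earlier time. -/
theorem wealth_eq (c : ℝ) {k n : ℕ} (hk : k ≤ n + 1) (x : Ω) :
    c + P.gain (P.optStrategy μ c) n x = P.rhoSum μ k n x +
      (c + P.gainBefore (P.optStrategy μ c) k x) * P.tailProd (P.beta μ) k n x := by
  rw [gain_optStrategy]
  cases k with
  | zero =>
    -- As ΔS_0 = 0, date 0 contributes a factor 1 and a summand 0, so k = 0 reduces to k = 1.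
    have h0 : P.dS 0 x = 0 := rfl
    rw [wealth_eq_succ c (Nat.zero_le n), rhoSum_left (Nat.zero_le n),
      tailProd_left (Nat.zero_le n), h0, dotProduct_zero, dotProduct_zero]
    simp [gainBefore, optGain]
  | succ k => rw [wealth_eq_succ c (Nat.le_of_succ_le_succ hk), gainBefore, gain_optStrategy]

theorem IsRegular.measurable_error_sq (hP : P.IsRegular μ) {g : Ω → ℝ} {n : ℕ} (hn : n ≤ P.N)
    (hg : Measurable g) : Measurable fun x => P.w n x * (P.H n x - g x) ^ 2 :=
  (hP.measurable_w' hn).mul (((hP.measurable_H' hn).sub hg).pow_const 2)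

theorem ofReal_sum_of_ae_nonneg {N : ℕ} {f : ℕ → Ω → ℝ} (hf : ∀ i ≤ N, Measurable (f i))
    (h0 : ∀ i ≤ N, ∀ᵐ x ∂μ, 0 ≤ f i x) :
    ∑ i ∈ range (N + 1), ∫⁻ x, ENNReal.ofReal (f i x) ∂μ =
      ∫⁻ x, ENNReal.ofReal (∑ i ∈ Icc 0 N, f i x) ∂μ := by
  rw [← lintegral_finsetSum' _ fun i hi =>
    (hf i (Nat.lt_succ_iff.1 (Finset.mem_range.1 hi))).ennreal_ofReal.aemeasurable]
  have h : ∀ᵐ x ∂μ, ∀ i, i ≤ N → 0 ≤ f i x := ae_all_iff.2 fun i => by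
    by_cases hi : i ≤ N
    · filter_upwards [h0 i hi] with x hx _ using hx
    · exact ae_of_all _ fun x h => absurd h hi
  refine lintegral_congr_ae ?_
  filter_upwards [h] with x hx
  rw [ENNReal.ofReal_sum_of_nonneg fun i hi => hx i (Finset.mem_Icc.1 hi).2,
    Nat.range_succ_eq_Icc_zero]

theorem IsRegular.cost_optStrategy (hP : P.IsRegular μ) (c : ℝ) :
    P.cost μ (P.optStrategy μ c) c = ∫⁻ x, ENNReal.ofReal
      (c ^ 2 * P.sumA μ 0 x - 2 * c * P.sumD μ 0 x + P.sumQ μ 0 x) ∂μ := by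
  have hadm := hP.admissible_optStrategy c
  rw [cost, ofReal_sum_of_ae_nonneg]
  · refine lintegral_congr fun x => ?_
    rw [quadratic_eq]
    congr 1
    refine Finset.sum_congr rfl fun i _ => ?_
    rw [sub_sub, wealth_eq (k := 1) c (by omega), sub_sub, gainBefore, gain_zero, add_zero]
  · intro i hi
    have hg := (hP.measurable_gain hadm hi).mono (P.filt.le i) le_rfl
    simpa only [sub_sub] using hP.measurable_error_sq hi (hg.const_add c)
  · intro i hi
    filter_upwards [hP.w_mem i hi] with x hx using mul_nonneg hx.1 (sq_nonneg _)

variable [IsProbabilityMeasure μ]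

/-- The right side is the cost of using ξ up to time n and the optimal recursion afterwards. Each
increase of n replaces one optimal position by ξ, which cannot lower the cost. -/
theorem IsRegular.lintegral_quadratic_zero_le (hP : P.IsRegular μ) (c : ℝ)
    {ξ : ℕ → Ω → Fin M → ℝ} (hξ : P.Admissible ξ) {n : ℕ} (hn : n ≤ P.N) :
    ∫⁻ x, ENNReal.ofReal (c ^ 2 * P.sumA μ 0 x - 2 * c * P.sumD μ 0 x + P.sumQ μ 0 x) ∂μ ≤
      ∑ i ∈ range n, ∫⁻ x, ENNReal.ofReal (P.w i x * (P.H i x - c - P.gain ξ i x) ^ 2) ∂μ +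
      ∫⁻ x, ENNReal.ofReal ((c + P.gain ξ n x) ^ 2 * P.sumA μ n x -
        2 * (c + P.gain ξ n x) * P.sumD μ n x + P.sumQ μ n x) ∂μ := by
  induction n with
  | zero => simp [gain_zero]
  | succ n ih =>
    refine (ih (by omega)).trans ?_
    rw [Finset.sum_range_succ, add_assoc]
    refine add_le_add le_rfl ?_
    have hg : Measurable[P.filt n] fun x => c + P.gain ξ n x :=
      (hP.measurable_gain hξ (by omega)).const_add c
    have hstep := (hP.invariant hn).lintegral_quadratic_le hP hn hg (hξ n hn)
    simp only [gain_succ, ← add_assoc]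
    refine le_trans ?_ (add_le_add le_rfl hstep)
    rw [← lintegral_add_left (by
      have := hP.measurable_error_sq (by omega : n ≤ P.N) (hg.mono (P.filt.le n) le_rfl)
      simp only [sub_sub]
      exact this.ennreal_ofReal)]
    refine lintegral_mono fun x => ?_
    rw [quadratic_left (by omega)]
    simp only [sub_sub]
    -- Only subadditivity of `ENNReal.ofReal` is needed, so the signs of the summands play no role.
    exact ENNReal.ofReal_add_le

/-- At n = N the optimal tail is just the terminal squared error, so the interpolated cost is that
of ξ. -/
theorem IsRegular.cost_optStrategy_le (hP : P.IsRegular μ) (c : ℝ) {ξ : ℕ → Ω → Fin M → ℝ}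
    (hξ : P.Admissible ξ) : P.cost μ (P.optStrategy μ c) c ≤ P.cost μ ξ c := by
  rw [hP.cost_optStrategy]
  refine (hP.lintegral_quadratic_zero_le c hξ le_rfl).trans (le_of_eq ?_)
  rw [cost, Finset.sum_range_succ]
  congr 1
  refine lintegral_congr fun x => ?_
  rw [quadratic_eq, Finset.Icc_self, Finset.sum_singleton, rhoSum_of_lt (Nat.lt_succ_self _),
    tailProd_of_lt (Nat.lt_succ_self _)]
  congr 1
  ring

theorem IsRegular.integrable_quadratic (hP : P.IsRegular μ) (c : ℝ) :
    Integrable (fun x => c ^ 2 * P.sumA μ 0 x - 2 * c * P.sumD μ 0 x + P.sumQ μ 0 x) μ := by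
  have hI := hP.invariant (Nat.zero_le P.N)
  exact (((hI.integrable_sumA hP).const_mul _).sub ((hI.integrable_sumD hP).const_mul _)).add
    (hI.integrable_sumQ hP)

theorem IsRegular.cost_optStrategy_lt_top (hP : P.IsRegular μ) (c : ℝ) :
    P.cost μ (P.optStrategy μ c) c < ∞ := by
  rw [hP.cost_optStrategy]
  exact (hP.integrable_quadratic c).lintegral_lt_top

theorem IsRegular.value_eq (hP : P.IsRegular μ) (c : ℝ) :
    P.value μ c = P.cost μ (P.optStrategy μ c) c :=
  le_antisymm (iInf₂_le _ (hP.admissible_optStrategy c))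
    (le_iInf₂ fun _ hξ => hP.cost_optStrategy_le c hξ)

theorem IsRegular.integrable_w_mul_tailProd_sq (hP : P.IsRegular μ) {n : ℕ} (hn : n ≤ P.N) :
    Integrable (fun x => P.w n x * P.tailProd (P.beta μ) 1 n x ^ 2) μ := by
  have hI := hP.invariant (Nat.zero_le P.N)
  refine (hI.integrable_sumA hP).mono' ((hP.measurable_w' hn).mul
    ((hP.measurable_tailProd hn).pow_const 2)).aestronglyMeasurable ?_
  filter_upwards [hP.ae_w_mem] with x hx
  rw [Real.norm_eq_abs, abs_of_nonneg (mul_nonneg (hx n hn).1 (sq_nonneg _))]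
  exact Finset.single_le_sum
    (f := fun i => P.w i x * P.tailProd (P.beta μ) (0 + 1) i x ^ 2)
    (fun i hi => mul_nonneg (hx i (Finset.mem_Icc.1 hi).2).1 (sq_nonneg _))
    (Finset.mem_Icc.2 ⟨Nat.zero_le n, hn⟩)

theorem IsRegular.integrable_w_mul_residual_sq (hP : P.IsRegular μ) {n : ℕ} (hn : n ≤ P.N) :
    Integrable (fun x => P.w n x * (P.H n x - P.rhoSum μ 1 n x) ^ 2) μ := by
  have hI := hP.invariant (Nat.zero_le P.N)
  refine (hI.integrable_sumQ hP).mono'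
    (hP.measurable_error_sq hn (hP.measurable_rhoSum hn)).aestronglyMeasurable ?_
  filter_upwards [hP.ae_w_mem] with x hx
  rw [Real.norm_eq_abs, abs_of_nonneg (mul_nonneg (hx n hn).1 (sq_nonneg _))]
  exact Finset.single_le_sum
    (f := fun i => P.w i x * (P.H i x - P.rhoSum μ (0 + 1) i x) ^ 2)
    (fun i hi => mul_nonneg (hx i (Finset.mem_Icc.1 hi).2).1 (sq_nonneg _))
    (Finset.mem_Icc.2 ⟨Nat.zero_le n, hn⟩)

theorem IsRegular.integrable_Z (hP : P.IsRegular μ) {n : ℕ} (hn : n ≤ P.N) :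
    Integrable (P.Z μ n) μ := by
  refine ((hP.integrable_w_mul_tailProd_sq hn).add (hP.integrable_w hn)).mono'
    ((hP.measurable_w' hn).mul (hP.measurable_tailProd hn)).aestronglyMeasurable ?_
  filter_upwards [hP.w_mem n hn] with x hx
  -- The one-term case, with r = 1 and u = 1.
  have := abs_mul_sum_le {n} (w := fun i => P.w i x) (by simpa using hx.1) (fun _ => 1)
    (fun i => P.tailProd (P.beta μ) 1 i x) 1
  simpa [Z] using this

theorem IsRegular.integrable_Z_mul_H (hP : P.IsRegular μ) {n : ℕ} (hn : n ≤ P.N) :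
    Integrable (fun x => P.Z μ n x * P.H n x) μ := by
  refine ((hP.integrable_w_mul_tailProd_sq hn).add (hP.integrable_w_mul_sq hn)).mono'
    (((hP.measurable_w' hn).mul (hP.measurable_tailProd hn)).mul
      (hP.measurable_H' hn)).aestronglyMeasurable ?_
  filter_upwards [hP.w_mem n hn] with x hx
  have := abs_mul_sum_le {n} (w := fun i => P.w i x) (by simpa using hx.1) (fun i => P.H i x)
    (fun i => P.tailProd (P.beta μ) 1 i x) 1
  simp only [Finset.sum_singleton, one_mul, one_pow] at this
  rwa [mul_right_comm] at this

/-- The invariant at time 0 trades the squared products in A_0 for the plain products in B_0, which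
is the sum of the Z_n. -/
theorem IsRegular.integral_sumA (hP : P.IsRegular μ) :
    ∫ x, P.sumA μ 0 x ∂μ = ∑ n ∈ range (P.N + 1), ∫ x, P.Z μ n x ∂μ := by
  have hI := hP.invariant (Nat.zero_le P.N)
  rw [← integral_genCondExp (P.filt.le 0) (hI.integrable_sumA hP), integral_congr_ae hI.eqAB,
    integral_genCondExp (P.filt.le 0) (hI.integrable_sumB hP), Nat.range_succ_eq_Icc_zero,
    ← integral_finsetSum _ fun n hn => hP.integrable_Z (Finset.mem_Icc.1 hn).2]
  rfl

/-- Likewise D_0 is traded for C_0, so ρ drops out of the coefficient of c. -/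
theorem IsRegular.integral_sumD (hP : P.IsRegular μ) :
    ∫ x, P.sumD μ 0 x ∂μ = ∑ n ∈ range (P.N + 1), ∫ x, P.Z μ n x * P.H n x ∂μ := by
  have hI := hP.invariant (Nat.zero_le P.N)
  rw [← integral_genCondExp (P.filt.le 0) (hI.integrable_sumD hP), ← integral_congr_ae hI.eqCD,
    integral_genCondExp (P.filt.le 0) (hI.integrable_sumC hP), Nat.range_succ_eq_Icc_zero,
    ← integral_finsetSum _ fun n hn => hP.integrable_Z_mul_H (Finset.mem_Icc.1 hn).2]
  refine integral_congr_ae (ae_of_all _ fun x => Finset.sum_congr rfl fun i _ => ?_)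
  simp only [Z, zero_add]
  ring

theorem IsRegular.integral_sumQ (hP : P.IsRegular μ) :
    ∫ x, P.sumQ μ 0 x ∂μ =
      ∑ n ∈ range (P.N + 1), ∫ x, P.w n x * (P.H n x - P.rhoSum μ 1 n x) ^ 2 ∂μ := by
  rw [Nat.range_succ_eq_Icc_zero, ← integral_finsetSum _ fun n hn =>
    hP.integrable_w_mul_residual_sq (Finset.mem_Icc.1 hn).2]
  rfl

theorem IsRegular.value_toReal (hP : P.IsRegular μ) (c : ℝ) :
    (P.value μ c).toReal = c ^ 2 * ∑ n ∈ range (P.N + 1), ∫ x, P.Z μ n x ∂μ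
      - 2 * c * ∑ n ∈ range (P.N + 1), ∫ x, P.Z μ n x * P.H n x ∂μ
      + ∑ n ∈ range (P.N + 1), ∫ x, P.w n x * (P.H n x - P.rhoSum μ 1 n x) ^ 2 ∂μ := by
  have hI := hP.invariant (Nat.zero_le P.N)
  have hA := (hI.integrable_sumA hP).const_mul (c ^ 2)
  have hD := (hI.integrable_sumD hP).const_mul (2 * c)
  rw [hP.value_eq, hP.cost_optStrategy, ← integral_eq_lintegral_of_nonneg_ae
    (by filter_upwards [hP.ae_quadratic_nonneg 0] with x hx using hx c)
    (hP.integrable_quadratic c).aestronglyMeasurable,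
    integral_add (f := fun x => c ^ 2 * P.sumA μ 0 x - 2 * c * P.sumD μ 0 x) (hA.sub hD)
    (hI.integrable_sumQ hP), integral_sub hA hD, integral_const_mul,
    integral_const_mul, hP.integral_sumA, hP.integral_sumD, hP.integral_sumQ]

end HedgingProblem

theorem mainTheorem4 {Ω : Type*} [MeasurableSpace Ω] (μ : Measure Ω) [IsProbabilityMeasure μ]
    {M : ℕ} (P : HedgingProblem Ω M)
    -- the price process is adapted and locally square integrable
    (hS : ∀ n ≤ P.N, Measurable[P.filt n] (P.S n))
    (hS2 : ∀ n, 1 ≤ n → n ≤ P.N → ∀ a : Fin M,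
      CondIntegrable μ (P.filt (n - 1)) (fun x => P.dS n x a ^ 2))
    -- the weights are adapted with values in `[0, 1]`
    (hw : ∀ n ≤ P.N, Measurable[P.filt n] (P.w n))
    (hw01 : ∀ n ≤ P.N, ∀ᵐ x ∂μ, P.w n x ∈ Set.Icc (0 : ℝ) 1)
    -- the claims are adapted and square integrable
    (hH : ∀ n ≤ P.N, Measurable[P.filt n] (P.H n))
    (hH2 : ∀ n ≤ P.N, MemLp (P.H n) 2 μ) :
    -- the conditional expectations `α`, `η`, `δ` are well defined, and the quotients
    -- `β = α / δ`, `ρ = η / δ` are solutions of `δ β = α`, `δ ρ = η`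
    (∀ n, 1 ≤ n → n ≤ P.N →
      (∀ a, CondIntegrable μ (P.filt (n - 1)) (P.alphaArg (P.beta μ) n a)) ∧
      (∀ a, CondIntegrable μ (P.filt (n - 1)) (P.etaArg (P.beta μ) n a)) ∧
      (∀ a a', CondIntegrable μ (P.filt (n - 1)) (P.deltaArg (P.beta μ) n a a')) ∧
      (∀ᵐ x ∂μ, P.delta μ n x *ᵥ P.beta μ n x = P.alpha μ n x ∧
        P.delta μ n x *ᵥ P.rho μ n x = P.eta μ n x)) ∧
    ∀ c : ℝ,
      -- the recursion for the strategy
      (∀ n, 1 ≤ n → n ≤ P.N → ∀ x, P.optStrategy μ c n x =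
        P.rho μ n x - (c + P.gain (P.optStrategy μ c) (n - 1) x) • P.beta μ n x) ∧
      -- (a) optimality and finiteness
      (P.Admissible (P.optStrategy μ c) ∧
        (∀ ξ, P.Admissible ξ → P.cost μ (P.optStrategy μ c) c ≤ P.cost μ ξ c) ∧
        P.value μ c = P.cost μ (P.optStrategy μ c) c ∧
        P.value μ c < ∞) ∧
      -- (b) the value function, all expectations being finite
      ((∀ n ≤ P.N, Integrable (P.Z μ n) μ ∧ Integrable (fun x => P.Z μ n x * P.H n x) μ ∧
          Integrable (fun x => P.w n x * (P.H n x - P.rhoSum μ 1 n x) ^ 2) μ) ∧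
        (P.value μ c).toReal =
          c ^ 2 * ∑ n ∈ range (P.N + 1), ∫ x, P.Z μ n x ∂μ
          - 2 * c * ∑ n ∈ range (P.N + 1), ∫ x, P.Z μ n x * P.H n x ∂μ
          + ∑ n ∈ range (P.N + 1), ∫ x, P.w n x * (P.H n x - P.rhoSum μ 1 n x) ^ 2 ∂μ) ∧
      -- (c) the recursive representation of the error
      (∀ n ≤ P.N, ∀ k ≤ n + 1, ∀ x,
        P.H n x - c - P.gain (P.optStrategy μ c) n x =
          P.H n x - P.rhoSum μ k n x
          - (c + P.gainBefore (P.optStrategy μ c) k x) * P.tailProd (P.beta μ) k n x) := by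
  have hP : P.IsRegular μ := ⟨hS, hS2, hw, hw01, hH, hH2⟩
  refine ⟨fun n h1 hn => ?_, fun c => ⟨fun n hn _ x => P.optStrategy_eq μ c hn x,
    ⟨hP.admissible_optStrategy c, fun ξ hξ => hP.cost_optStrategy_le c hξ, hP.value_eq c,
      (hP.value_eq c).trans_lt (hP.cost_optStrategy_lt_top c)⟩,
    ⟨fun n hn => ⟨hP.integrable_Z hn, hP.integrable_Z_mul_H hn,
      hP.integrable_w_mul_residual_sq hn⟩, hP.value_toReal c⟩, fun n _ k hk x => ?_⟩⟩
  · obtain ⟨n, rfl⟩ : ∃ k, n = k + 1 := ⟨n - 1, by omega⟩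
    have hI := hP.invariant hn
    -- `alphaArg`, `etaArg` and `deltaArg` at β unfold to increments times `sumB`, `sumC` and
    -- `sumA`.
    refine ⟨fun a => (hI.condInt_mul_sumB hP hn a).condInt,
      fun a => (hI.condInt_mul_sumC hP hn a).condInt,
      fun a a' => (hI.condInt_mul_mul hP hn a a').condInt, ?_⟩
    filter_upwards [hI.delta_mulVec_beta hP hn, hI.delta_mulVec_rho hP hn] with x h1 h2
    exact ⟨h1, h2⟩
  · rw [sub_sub, HedgingProblem.wealth_eq c hk, sub_sub]
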